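/- For every integer $d\ge 0$ there is a constant $C(d)>0$, depending only on $d$, with the following property. Let $M$ be a closed connected $d$-dimensional Riemannian manifold, $\widetilde M$ its universal cover with the induced Riemannian metric, and $\Gamma\cong\pi_1(M)$ its deck transformation group. Let $X$ be the Cantor set, endowed with a free continuous $\Gamma$-action and a $\Gamma$-invariant Borel probability measure $\mu$. A \emph{Cantor cover} of $X\times\widetilde M$ is a cover $\mathcal U=\{A_j\times B_j\mid j\in J\}$, indexed by a free $\Gamma$-set $J$ with finitely many orbits, where $A_j\subset X$ is clopen, $B_j=B(m_j,r_j)\subset\widetilde M$ is an open ball of radius $r_j>0$, $A_{\gamma j}=\gamma A_j$, $m_{\gamma j}=\gamma m_j$, $r_{\gamma j}=r_j$ for $\gamma\in\Gamma$, and the sets $A_j\times\frac12B_j$ still cover $X\times\widetilde M$ (where $aB_j=B(m_j,ar_j)$). It has \emph{no self-intersections} if $(\gamma A_j\times\gamma B_j)\cap(A_j\times B_j)\neq\emptyset$ implies $\gamma=1$. It is \emph{good} if for each $x\in X$ the family $\mathcal U_x=(B_j)_{j\in J,\,x\in A_j}$ covers $\widetilde M$, the balls $\frac12B_j$ of this family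 still cover $\widetilde M$, the balls $\frac16B_j$ of this family are pairwise disjoint, and each $B_j=B(m_j,r_j)$ of this family satisfies $\operatorname{vol}(B(m_j,100r_j))\le 10^{4(d+3)}\operatorname{vol}(B(m_j,\frac1{100}r_j))$, $\operatorname{vol}(B(m_j,r_j))\le 10^{2(d+3)}V(1)\,r_j^{d+3}$ and $r_j\le\frac1{100}$, where $V(1)$ is the supremum of the volumes of the balls of radius $1$ in $\widetilde M$. Let $\mathcal U$ be a good Cantor cover of $X\times\widetilde M$ without self-intersections. Let $N((r_j)_{j\in J})$ be the rectangular complex whose closed faces are the sets $F$ of all $(b_j)_{j\in J}$ with $b_j\in[0,r_j]$ for $j\in J_{1/2}(F)$, $b_j=r_j$ for $j\in J_1(F)$ and $b_j=0$ for all other $j$, where $J_{1/2}(F)$ and $J_1(F)\neq\emptyset$ are disjoint finite subsets of $J$; it carries the path metric induced by the Euclidean metrics on its faces. For $x\in X$ let $N(\mathcal U_x)$ be the union of the faces $F$ such that $x\in A_j$ for all $j\in J_{1/2}(F)\cup J_1(F)$ and $\bigcap_{j\in J_{1/2}(F)\cup J_1(F)}B_j\neq\emptyset$, with the restricted metric.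 The \emph{rectangular Cantor nerve} is $N^{\mathrm{Ca}}(\mathcal U)=\{(x,b)\mid x\in X,\ b\in N(\mathcal U_x)\}\subset X\times N((r_j)_{j\in J})$ with the diagonal $\Gamma$-action, where $(\gamma b)_j=b_{\gamma^{-1}j}$, and the \emph{Cantor nerve map} is the $\Gamma$-equivariant map $$\Phi\colon X\times\widetilde M\to N^{\mathrm{Ca}}(\mathcal U),\qquad \Phi(x,p)=\bigl(x,(\Phi_j(x,p))_{j\in J}\bigr),$$ where $\Phi_j(x,p)=0$ if $x\notin A_j$ or $d(p,m_j)\ge r_j$, $\Phi_j(x,p)=2(r_j-d(p,m_j))$ if $x\in A_j$ and $\frac{r_j}2\le d(p,m_j)\le r_j$, and $\Phi_j(x,p)=r_j$ if $x\in A_j$ and $d(p,m_j)<\frac{r_j}2$. Let $\phi$ be the map on $\Gamma$-orbit spaces induced by $\Phi$. The \emph{transverse $d$-volume} of $\Phi$ is $$\operatorname{vol}^{\mathrm{tr}}_d(\Phi)=\int_{\Gamma\backslash N^{\mathrm{Ca}}(\mathcal U)}\#\phi^{-1}(\{w\})\,d\operatorname{vol}^{\mathrm{tr}}_d(w)=\int_X\int_{F_x}\#\phi^{-1}(\{\Gamma(x,b)\})\,d\mathcal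 H^d_x(b)\,d\mu(x),$$ where $F\subset N^{\mathrm{Ca}}(\mathcal U)$ is any Borel fundamental domain of the $\Gamma$-action, $F_x=\{b\mid(x,b)\in F\}$, and $\mathcal H^d_x$ is the $d$-dimensional Hausdorff measure (normalized as usual) of $N(\mathcal U_x)$. Then the Cantor nerve map $\Phi$ is well defined, a Borel fundamental domain $F$ exists, and for each such $F$ $$\operatorname{vol}^{\mathrm{tr}}_d(\Phi)\le C(d)\cdot\operatorname{vol}(M).$$ -/

import Mathlib

open Set MeasureTheory Metric Manifold Bundle
open scoped ENNReal ContDiff Pointwise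

noncomputable section

/-! ### Rectangular complexes -/

section RectangularComplex

variable {J : Type*}

/-- A face of the rectangular complex associated with a family `(a j)` of side lengths: in the
coordinates of `half` the face is the full interval `[0, a j]`, in the coordinates of `one` it is
the point `a j`, in all the other coordinates it is `0`. At least one coordinate is in `one`. -/
structure RectFace (J : Type*) where
  half : Finset J
  one : Finset J
  disjoint : Disjoint half one
  one_nonempty : one.Nonempty

/-- The index set `J_+(F)`. -/
def RectFace.plus (F : RectFace J) : Set J := {j | j ∈ F.half ∨ j ∈ F.one}

/-- The closed cuboid of a face. -/
def RectFace.cuboid (F : RectFace J) (a : J → ℝ) : Set (J → ℝ) :=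
  {b | (∀ j ∈ F.half, b j ∈ Icc 0 (a j)) ∧ (∀ j ∈ F.one, b j = a j) ∧ ∀ j ∉ F.plus, b j = 0}

/-- The rectangular complex `N((a j))`: the union of all the closed faces. All its points are
finitely supported. -/
@[ext]
structure RectComplex (a : J → ℝ) where
  coord : J → ℝ
  mem : ∃ F : RectFace J, coord ∈ F.cuboid a

/-- The Euclidean distance of two points in a common face. -/
def euclidDist (b c : J → ℝ) : ℝ := Real.sqrt (∑ᶠ j, (b j - c j) ^ 2)

/-- `s 0, …, s n` is a string from `p` to `q`: consecutive points lie in a common face. -/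
def IsRectString {a : J → ℝ} (p q : RectComplex a) (n : ℕ) (s : ℕ → RectComplex a) : Prop :=
  s 0 = p ∧ s n = q ∧
    ∀ i < n, ∃ F : RectFace J, (s i).coord ∈ F.cuboid a ∧ (s (i + 1)).coord ∈ F.cuboid a

/-- The length of a string. -/
def rectStringLength {a : J → ℝ} (n : ℕ) (s : ℕ → RectComplex a) : ℝ≥0∞ :=
  ∑ i ∈ Finset.range n, ENNReal.ofReal (euclidDist (s i).coord (s (i + 1)).coord)

/-- The path metric of the complex induced by the Euclidean metrics of its faces: the infimum of
the lengths of all piecewise linear paths. -/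
def rectPathEDist {a : J → ℝ} (p q : RectComplex a) : ℝ≥0∞ :=
  ⨅ (n : ℕ) (s : ℕ → RectComplex a) (_ : IsRectString p q n s), rectStringLength n s

theorem euclidDist_comm (b c : J → ℝ) : euclidDist b c = euclidDist c b := by
  unfold euclidDist
  congr 1
  exact finsum_congr fun j => by ring

theorem RectFace.finite_support_sub (F : RectFace J) {a b c : J → ℝ} (hb : b ∈ F.cuboid a)
    (hc : c ∈ F.cuboid a) : (Function.support fun j => (b j - c j) ^ 2).Finite := by
  refine (F.half.finite_toSet.union F.one.finite_toSet).subset fun j hj => ?_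
  by_contra h
  have hj' : j ∉ F.plus := h
  exact hj (by simp [hb.2.2 j hj', hc.2.2 j hj'])

theorem RectFace.abs_sub_le (F : RectFace J) {a b c : J → ℝ} (hb : b ∈ F.cuboid a)
    (hc : c ∈ F.cuboid a) (j : J) : |b j - c j| ≤ euclidDist b c := by
  unfold euclidDist
  rw [← Real.sqrt_sq_eq_abs]
  apply Real.sqrt_le_sqrt
  exact single_le_finsum j (F.finite_support_sub hb hc) fun i => sq_nonneg _

theorem edist_coord_le_length {a : J → ℝ} (j : J) {n : ℕ} {p q : RectComplex a}
    {s : ℕ → RectComplex a} (h : IsRectString p q n s) :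
    edist (p.coord j) (q.coord j) ≤ rectStringLength n s := by
  obtain ⟨rfl, rfl, h⟩ := h
  refine (edist_le_range_sum_edist (fun i => (s i).coord j) n).trans ?_
  refine Finset.sum_le_sum fun i hi => ?_
  obtain ⟨F, h1, h2⟩ := h i (Finset.mem_range.1 hi)
  rw [edist_dist, Real.dist_eq]
  exact ENNReal.ofReal_le_ofReal (F.abs_sub_le h1 h2 j)

theorem rectPathEDist_self {a : J → ℝ} (p : RectComplex a) : rectPathEDist p p = 0 := by
  refine le_antisymm (iInf_le_of_le 0 (iInf_le_of_le (fun _ => p) (iInf_le_of_le ?_ ?_))) bot_le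
  · exact ⟨rfl, rfl, fun i hi => absurd hi (Nat.not_lt_zero i)⟩
  · simp [rectStringLength]

theorem rectPathEDist_le_symm {a : J → ℝ} (p q : RectComplex a) :
    rectPathEDist p q ≤ rectPathEDist q p := by
  refine le_iInf fun n => le_iInf fun s => le_iInf fun h => ?_
  obtain ⟨h0, h1, h2⟩ := h
  refine iInf_le_of_le n (iInf_le_of_le (fun i => s (n - i)) (iInf_le_of_le ⟨?_, ?_, ?_⟩ ?_))
  · simpa using h1
  · simpa using h0
  · intro i hi
    obtain ⟨F, hF1, hF2⟩ := h2 (n - (i + 1)) (by omega)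
    rw [show n - (i + 1) + 1 = n - i by omega] at hF2
    exact ⟨F, hF2, hF1⟩
  · unfold rectStringLength
    rw [← Finset.sum_range_reflect]
    refine le_of_eq (Finset.sum_congr rfl fun i hi => ?_)
    have hi' := Finset.mem_range.1 hi
    rw [euclidDist_comm]
    simp only []
    rw [show n - (n - 1 - i + 1) = i by omega, show n - (n - 1 - i) = i + 1 by omega]

theorem rectPathEDist_triangle {a : J → ℝ} (p q r : RectComplex a) :
    rectPathEDist p r ≤ rectPathEDist p q + rectPathEDist q r := by
  unfold rectPathEDist
  simp only [ENNReal.iInf_add, ENNReal.add_iInf]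
  refine le_iInf fun n => le_iInf fun t => le_iInf fun ht =>
    le_iInf fun m => le_iInf fun s => le_iInf fun hs => ?_
  obtain ⟨s0, s1, s2⟩ := hs
  obtain ⟨t0, t1, t2⟩ := ht
  let u : ℕ → RectComplex a := fun i => if i ≤ m then s i else t (i - m)
  have hu1 : ∀ i, i ≤ m → u i = s i := fun i hi => if_pos hi
  have hu2 : ∀ i, u (m + i) = t i := by
    intro i
    rcases Nat.eq_zero_or_pos i with rfl | hi
    · rw [Nat.add_zero, hu1 m le_rfl, s1, t0]
    · simp only [u]
      rw [if_neg (by omega), Nat.add_sub_cancel_left]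
  refine iInf_le_of_le (m + n) (iInf_le_of_le u (iInf_le_of_le ⟨?_, ?_, ?_⟩ ?_))
  · rw [hu1 0 (Nat.zero_le _), s0]
  · rw [hu2, t1]
  · intro i hi
    rcases lt_or_ge i m with h | h
    · rw [hu1 i h.le, hu1 (i + 1) h]
      exact s2 i h
    · obtain ⟨k, rfl⟩ := Nat.exists_eq_add_of_le h
      rw [hu2, Nat.add_assoc, hu2]
      exact t2 k (by omega)
  · unfold rectStringLength
    rw [Finset.sum_range_add]
    refine le_of_eq (congrArg₂ (· + ·) (Finset.sum_congr rfl fun i hi => ?_)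
      (Finset.sum_congr rfl fun i hi => ?_))
    · have := Finset.mem_range.1 hi
      rw [hu1 i this.le, hu1 (i + 1) this]
    · rw [hu2, Nat.add_assoc, hu2]

instance RectComplex.instEMetricSpace (a : J → ℝ) : EMetricSpace (RectComplex a) where
  edist := rectPathEDist
  edist_self := rectPathEDist_self
  edist_comm p q := le_antisymm (rectPathEDist_le_symm p q) (rectPathEDist_le_symm q p)
  edist_triangle := rectPathEDist_triangle
  eq_of_edist_eq_zero := by
    intro p q h
    ext j
    have h' : edist (p.coord j) (q.coord j) ≤ rectPathEDist p q :=
      le_iInf fun n => le_iInf fun s => le_iInf fun hs => edist_coord_le_length j hs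
    change rectPathEDist p q = 0 at h
    rw [h] at h'
    exact edist_le_zero.1 h'

instance RectComplex.instMeasurableSpace (a : J → ℝ) : MeasurableSpace (RectComplex a) := borel _

instance RectComplex.instBorelSpace (a : J → ℝ) : BorelSpace (RectComplex a) := ⟨rfl⟩

end RectangularComplex

/-! ### Good balls and good covers -/

section Good

variable {Y : Type*} [MetricSpace Y] [MeasurableSpace Y] [BorelSpace Y]

/-- The supremal volume of balls of radius `1`. The `d`-dimensional volume of a `d`-dimensional
Riemannian manifold is its normalized `d`-dimensional Hausdorff measure `μHE[d]`. -/
def supUnitBallVolume (d : ℕ) (Y : Type*) [MetricSpace Y] [MeasurableSpace Y] [BorelSpace Y] :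
    ℝ≥0∞ := ⨆ q : Y, μHE[d] (ball q 1)

/-- The ball of radius `r` around `q` is a good ball. -/
structure IsGoodBall (d : ℕ) (q : Y) (r : ℝ) : Prop where
  reasonable_growth :
    μHE[d] (ball q (100 * r)) ≤ 10 ^ (4 * (d + 3)) * μHE[d] (ball q (1 / 100 * r))
  volume_bound :
    μHE[d] (ball q r) ≤
      10 ^ (2 * (d + 3)) * supUnitBallVolume d Y * ENNReal.ofReal (r ^ (d + 3))
  small_radius : r ≤ 1 / 100

/-- The family of balls with centers `c i` and radii `r i` is a good cover. -/
structure IsGoodCover (d : ℕ) {ι : Type*} (c : ι → Y) (r : ι → ℝ) : Prop where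
  cover : ⋃ i, ball (c i) (r i) = univ
  good : ∀ i, IsGoodBall d (c i) (r i)
  sixth_disjoint : Pairwise fun i k => Disjoint (ball (c i) (1 / 6 * r i)) (ball (c k) (1 / 6 * r k))
  half_cover : ⋃ i, ball (c i) (1 / 2 * r i) = univ

end Good

/-! ### Cantor covers, their rectangular Cantor nerves, and transverse volume -/

/-- A Cantor cover `{A j × B j}` of `X × Y`: here `A j = base j` is clopen in `X`, and `B j` is the
open ball with center `center j` and radius `radius j` in `Y`. -/
structure CantorCover (Γ X Y J : Type*) [Group Γ] [TopologicalSpace X] [MulAction Γ X]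
    [MetricSpace Y] [MulAction Γ Y] [MulAction Γ J] where
  free : ∀ (γ : Γ) (j : J), γ • j = j → γ = 1
  cofinite : Finite (MulAction.orbitRel.Quotient Γ J)
  base : J → Set X
  center : J → Y
  radius : J → ℝ
  isClopen_base : ∀ j, IsClopen (base j)
  radius_pos : ∀ j, 0 < radius j
  base_smul : ∀ (γ : Γ) (j : J), base (γ • j) = γ • base j
  center_smul : ∀ (γ : Γ) (j : J), center (γ • j) = γ • center j
  radius_smul : ∀ (γ : Γ) (j : J), radius (γ • j) = radius j
  cover : ⋃ j, base j ×ˢ ball (center j) (radius j) = univ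
  half_cover : ⋃ j, base j ×ˢ ball (center j) (1 / 2 * radius j) = univ

namespace CantorCover

variable {Γ X Y J : Type*} [Group Γ] [TopologicalSpace X] [MulAction Γ X]
  [MetricSpace Y] [MulAction Γ Y] [MulAction Γ J]

/-- The ball `B j`. -/
def ball (U : CantorCover Γ X Y J) (j : J) : Set Y := Metric.ball (U.center j) (U.radius j)

/-- The cover has no self-intersections. -/
def NoSelfIntersections (U : CantorCover Γ X Y J) : Prop :=
  ∀ (γ : Γ) (j : J),
    (((γ • U.base j) ×ˢ (γ • U.ball j)) ∩ (U.base j ×ˢ U.ball j)).Nonempty → γ = 1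

/-- The cover is good: for each `x` the family of the balls `B j` with `x ∈ A j` is a good
cover. -/
def IsGood (d : ℕ) [MeasurableSpace Y] [BorelSpace Y] (U : CantorCover Γ X Y J) : Prop :=
  ∀ x : X, IsGoodCover d (fun j : {j // x ∈ U.base j} => U.center j)
    (fun j : {j // x ∈ U.base j} => U.radius j)

/-- A face `F` belongs to the rectangular nerve of the fiberwise cover `{B j | x ∈ A j}`. -/
def IsNerveFace (U : CantorCover Γ X Y J) (x : X) (F : RectFace J) : Prop :=
  (∀ j ∈ F.plus, x ∈ U.base j) ∧ (⋂ j ∈ F.plus, U.ball j).Nonempty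

/-- The rectangular nerve of the fiberwise cover `{B j | x ∈ A j}`, as a subcomplex of the
rectangular complex of the family of all the radii. -/
def fiberNerve (U : CantorCover Γ X Y J) (x : X) : Set (RectComplex U.radius) :=
  {b | ∃ F : RectFace J, U.IsNerveFace x F ∧ b.coord ∈ F.cuboid U.radius}

/-- The rectangular Cantor nerve. -/
def Nerve (U : CantorCover Γ X Y J) : Type _ :=
  {w : X × RectComplex U.radius // w.2 ∈ U.fiberNerve w.1}

instance (U : CantorCover Γ X Y J) : TopologicalSpace U.Nerve :=
  inferInstanceAs (TopologicalSpace {w : X × RectComplex U.radius // w.2 ∈ U.fiberNerve w.1})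

instance (U : CantorCover Γ X Y J) : MeasurableSpace U.Nerve := borel _

instance (U : CantorCover Γ X Y J) : BorelSpace U.Nerve := ⟨rfl⟩

/-- The translate of a face. -/
def _root_.RectFace.translate (γ : Γ) (F : RectFace J) : RectFace J where
  half := F.half.map (MulAction.toPerm γ).toEmbedding
  one := F.one.map (MulAction.toPerm γ).toEmbedding
  disjoint := (Finset.disjoint_map _).2 F.disjoint
  one_nonempty := F.one_nonempty.map

theorem _root_.RectFace.mem_map_toPerm (γ : Γ) (s : Finset J) (j : J) :
    j ∈ s.map (MulAction.toPerm γ).toEmbedding ↔ γ⁻¹ • j ∈ s := by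
  rw [Finset.mem_map_equiv]
  rfl

theorem _root_.RectFace.mem_plus_translate (γ : Γ) (F : RectFace J) (j : J) :
    j ∈ (F.translate γ).plus ↔ γ⁻¹ • j ∈ F.plus :=
  or_congr (RectFace.mem_map_toPerm γ _ j) (RectFace.mem_map_toPerm γ _ j)

theorem radius_inv_smul (U : CantorCover Γ X Y J) (γ : Γ) (j : J) :
    U.radius (γ⁻¹ • j) = U.radius j := U.radius_smul γ⁻¹ j

theorem mem_cuboid_translate (U : CantorCover Γ X Y J) (γ : Γ) (F : RectFace J) {b : J → ℝ}
    (hb : b ∈ F.cuboid U.radius) :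
    (fun j => b (γ⁻¹ • j)) ∈ (F.translate γ).cuboid U.radius := by
  refine ⟨fun j hj => ?_, fun j hj => ?_, fun j hj => ?_⟩
  · have := hb.1 _ ((RectFace.mem_map_toPerm γ _ j).1 hj)
    rwa [U.radius_inv_smul] at this
  · have := hb.2.1 _ ((RectFace.mem_map_toPerm γ _ j).1 hj)
    rwa [U.radius_inv_smul] at this
  · exact hb.2.2 _ fun h => hj ((RectFace.mem_plus_translate γ F j).2 h)

/-- The left shift action on the rectangular complex. -/
instance (U : CantorCover Γ X Y J) : MulAction Γ (RectComplex U.radius) where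
  smul γ b := ⟨fun j => b.coord (γ⁻¹ • j), by
    obtain ⟨F, hF⟩ := b.mem
    exact ⟨F.translate γ, U.mem_cuboid_translate γ F hF⟩⟩
  one_smul b := by
    ext j
    change b.coord ((1 : Γ)⁻¹ • j) = b.coord j
    simp
  mul_smul γ δ b := by
    ext j
    change b.coord ((γ * δ)⁻¹ • j) = b.coord (δ⁻¹ • γ⁻¹ • j)
    rw [mul_inv_rev, mul_smul]

theorem smul_ball [IsIsometricSMul Γ Y] (U : CantorCover Γ X Y J) (γ : Γ) (j : J) :
    U.ball (γ • j) = γ • U.ball j := by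
  unfold ball
  rw [Metric.smul_ball, U.center_smul, U.radius_smul]

theorem IsNerveFace.translate [IsIsometricSMul Γ Y] {U : CantorCover Γ X Y J} {x : X}
    {F : RectFace J} (h : U.IsNerveFace x F) (γ : Γ) :
    U.IsNerveFace (γ • x) (F.translate γ) := by
  refine ⟨fun j hj => ?_, ?_⟩
  · have h1 := h.1 _ ((RectFace.mem_plus_translate γ F j).1 hj)
    rw [U.base_smul] at h1
    rwa [mem_smul_set_iff_inv_smul_mem, inv_inv] at h1
  · obtain ⟨q, hq⟩ := h.2
    refine ⟨γ • q, mem_iInter₂.2 fun j hj => ?_⟩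
    have h1 := mem_iInter₂.1 hq _ ((RectFace.mem_plus_translate γ F j).1 hj)
    rw [U.smul_ball] at h1
    rwa [mem_smul_set_iff_inv_smul_mem, inv_inv] at h1

/-- The diagonal action on the rectangular Cantor nerve. -/
instance [IsIsometricSMul Γ Y] (U : CantorCover Γ X Y J) : MulAction Γ U.Nerve where
  smul γ w := ⟨(γ • w.1.1, γ • w.1.2), by
    obtain ⟨F, hF, hb⟩ := w.2
    exact ⟨F.translate γ, hF.translate γ, U.mem_cuboid_translate γ F hb⟩⟩
  one_smul w := Subtype.ext (Prod.ext (one_smul Γ w.1.1) (one_smul Γ w.1.2))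
  mul_smul γ δ w := Subtype.ext (Prod.ext (mul_smul γ δ w.1.1) (mul_smul γ δ w.1.2))

open Classical in
/-- The `j`-th component of the Cantor nerve map. -/
def nerveCoord (U : CantorCover Γ X Y J) (j : J) (v : X × Y) : ℝ :=
  if U.radius j ≤ dist v.2 (U.center j) ∨ v.1 ∉ U.base j then 0
  else if U.radius j / 2 ≤ dist v.2 (U.center j) then
    2 * (U.radius j - dist v.2 (U.center j))
  else U.radius j

/-- `Φ` is the Cantor nerve map `(x, p) ↦ (x, (Φ_j(x, p))_j)`. -/
def IsNerveMap [IsIsometricSMul Γ Y] (U : CantorCover Γ X Y J) (Φ : X × Y →[Γ] U.Nerve) : Prop :=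
  ∀ v : X × Y, (Φ v).1.1 = v.1 ∧ ∀ j, (Φ v).1.2.coord j = U.nerveCoord j v

/-- The integral of `f` with respect to the `d`-dimensional Hausdorff measure
`∫ x, ℋ^d_x dμ(x)` of the metric Cantor bundle `U.Nerve`; here `ℋ^d_x` is the `d`-dimensional
Hausdorff measure of the fiber over `x`. -/
def lintegralVol (d : ℕ) [MeasurableSpace X] (μ : Measure X) (U : CantorCover Γ X Y J)
    (f : U.Nerve → ℝ≥0∞) : ℝ≥0∞ :=
  ∫⁻ x, ∫⁻ b : U.fiberNerve x, f ⟨(x, b.1), b.2⟩ ∂(μHE[d]) ∂μ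

end CantorCover

/-- A Borel fundamental domain: a Borel set that meets each orbit in exactly one point, and at
exactly one group element. -/
def IsBorelFundamentalDomain (Γ : Type*) {W : Type*} [Group Γ] [MulAction Γ W] [MeasurableSpace W]
    (F : Set W) : Prop :=
  MeasurableSet F ∧ ∀ w : W, ∃! γ : Γ, γ • w ∈ F

/-- The map of orbit spaces induced by an equivariant map. -/
def orbitMap {Γ V W : Type*} [Group Γ] [MulAction Γ V] [MulAction Γ W] (Φ : V →[Γ] W) :
    MulAction.orbitRel.Quotient Γ V → MulAction.orbitRel.Quotient Γ W :=
  Quotient.map' Φ (by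
    rintro v v' ⟨γ, rfl⟩
    exact ⟨γ, (map_smul Φ γ v').symm⟩)

/-- The transverse `d`-volume of an equivariant map `Φ` into the rectangular Cantor nerve, that is
the integral of `w ↦ #φ⁻¹(w)` over the orbit space with respect to the transverse `d`-dimensional
Hausdorff measure, where `φ` is the induced map of orbit spaces. The transverse measure is computed
with the fundamental domain `F`. -/
def CantorCover.transverseVolume {Γ X Y J V : Type*} [Group Γ] [TopologicalSpace X]
    [MeasurableSpace X] [MulAction Γ X] [MetricSpace Y] [MulAction Γ Y] [IsIsometricSMul Γ Y]
    [MulAction Γ J] [MulAction Γ V] (d : ℕ) (μ : Measure X) (U : CantorCover Γ X Y J)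
    (F : Set U.Nerve) (Φ : V →[Γ] U.Nerve) : ℝ≥0∞ :=
  U.lintegralVol d μ
    (F.indicator fun w => ((orbitMap Φ ⁻¹' {Quotient.mk'' w}).encard : ℝ≥0∞))

/-! ### Universal Riemannian coverings -/

/-- The group of deck transformations of a Riemannian covering `p`: the isometries over `p`. (Each
homeomorphism over a Riemannian covering with connected total space is an isometry.) -/
def deckGroup {M M' : Type*} [MetricSpace M'] (p : M' → M) : Subgroup (M' ≃ᵢ M') where
  carrier := {g | ∀ y, p (g y) = p y}
  mul_mem' := by
    intro g h hg hh y
    rw [IsometryEquiv.mul_apply, hg, hh]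
  one_mem' _ := rfl
  inv_mem' := by
    intro g hg y
    rw [← hg (g⁻¹ y), IsometryEquiv.apply_inv_self]

instance {M M' : Type*} [MetricSpace M'] (p : M' → M) : MulAction (deckGroup p) M' where
  smul g y := g.1 y
  one_smul _ := rfl
  mul_smul _ _ _ := rfl

instance {M M' : Type*} [MetricSpace M'] (p : M' → M) : IsIsometricSMul (deckGroup p) M' where
  isometry_smul g := g.1.isometry

/-- `p` is a Riemannian covering: a smooth covering map whose differentials are isometric. -/
structure IsRiemannianCovering (d : ℕ) {M M' : Type*}
    [TopologicalSpace M] [ChartedSpace (EuclideanSpace ℝ (Fin d)) M]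
    [RiemannianBundle fun q : M => TangentSpace (𝓡 d) q]
    [TopologicalSpace M'] [ChartedSpace (EuclideanSpace ℝ (Fin d)) M']
    [RiemannianBundle fun q : M' => TangentSpace (𝓡 d) q] (p : M' → M) : Prop where
  isCoveringMap : IsCoveringMap p
  surjective : Function.Surjective p
  contMDiff : ContMDiff (𝓡 d) (𝓡 d) ∞ p
  norm_mfderiv : ∀ (q : M') (v : TangentSpace (𝓡 d) q), ‖mfderiv (𝓡 d) (𝓡 d) p q v‖ = ‖v‖

end

/-! Let `m(x, p)` be the number of members of the cover that contain `(x, p)`. Where the set of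
these members is constant, `Φ(x, ·)` has only `m` nonzero coordinates, each of them 2-Lipschitz, so
it is Lipschitz with constant `2m`. The area inequality in each fiber, together with the fact that
`E = Φ⁻¹(F)` is a fundamental domain in `X × M'`, bounds the transverse volume by `2^d ∫_E m^d`
(`lintegral_fiber_le`).

No pointwise bound on `m` is needed, only a bound on its `d`-th moment. If the members at a point
are ordered by radius, then `m^(n+1) ≤ (n+1) ∑_k m_k^n`, where `k` runs over the members at the
point and `m_k` counts those of radius at most `r_k` (`card_pow_succ_le_sum`). The balls not larger
than `B_i` that meet `B_i` have disjoint sixths inside `100 B_i`; with `K = 10^(4(d+3))`, reasonable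
growth bounds their total volume by `K² vol(B_i)`. By induction the `n`-th moment of `m_i` over
`B_i` is at most `n! K^(2n) vol(B_i)` (`setLIntegral_levelMultiplicity_pow_le`). Unfolding an
integral over `E` into integrals over `X × M'`, replacing each ball by its sixth, and folding back
gives `∫_E m^d ≤ d! K^(2d) (μ × vol)(E)`, because the sets `A_j × (1/6)B_j` are disjoint.

Finally `(μ × vol)(E) ≤ vol(D) ≤ vol(M)` for a set `D` that meets every deck orbit; it is assembled
from 1-Lipschitz local sections of the covering (`exists_deckGroup_cover_measure_le`). -/

noncomputable section

/-! ### Smoothness of local inverses -/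

section LocalInverse

variable {d : ℕ} {N N' : Type*}
  [TopologicalSpace N] [ChartedSpace (EuclideanSpace ℝ (Fin d)) N]
  [TopologicalSpace N'] [ChartedSpace (EuclideanSpace ℝ (Fin d)) N']

/-- The inverse function theorem, read in charts. Injectivity of the differential suffices because
both tangent spaces have dimension `d`. -/
theorem contMDiffAt_symm_of_injective_mfderiv
    (h : OpenPartialHomeomorph N' N) {y : N'} (hy : y ∈ h.source)
    (hs : ContMDiffAt (𝓡 d) (𝓡 d) 1 h y)
    (hinj : Function.Injective (mfderiv (𝓡 d) (𝓡 d) h y)) :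
    ContMDiffAt (𝓡 d) (𝓡 d) 1 h.symm (h y) := by
  have hq : h y ∈ h.target := h.map_source hy
  let E := EuclideanSpace ℝ (Fin d)
  let L : E →L[ℝ] E := mfderiv (𝓡 d) (𝓡 d) h y
  have hL : Function.Injective (L : E →ₗ[ℝ] E) := hinj
  let L' : E ≃L[ℝ] E := (LinearEquiv.ofInjectiveEndo (L : E →ₗ[ℝ] E) hL).toContinuousLinearEquiv
  have hLL : (L' : E →L[ℝ] E) = L := by
    ext v
    rfl
  let e : OpenPartialHomeomorph E E := (chartAt E y).symm ≫ₕ h ≫ₕ chartAt E (h y)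
  have he1 : chartAt E (h y) (h y) ∈ e.target := by
    simp [e, hq, h.left_inv hy]
  have he2 : e.symm (chartAt E (h y) (h y)) = chartAt E y y := by
    simp [e, h.left_inv hy]
  have hd : HasFDerivAt e (L' : E →L[ℝ] E) (e.symm (chartAt E (h y) (h y))) := by
    rw [he2, hLL]
    have := (hs.mdifferentiableAt one_ne_zero).hasMFDerivAt.2
    simp only [modelWithCornersSelf_coe, range_id] at this
    exact (hasFDerivWithinAt_univ (𝕜 := ℝ) (E := E) (F := E)).1 this
  have hc : ContDiffAt ℝ 1 e (e.symm (chartAt E (h y) (h y))) := by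
    rw [he2]
    have := (contMDiffAt_iff.1 hs).2
    simp only [modelWithCornersSelf_coe, range_id, contDiffWithinAt_univ] at this
    exact this
  have key := e.contDiffAt_symm he1 hd hc
  rw [contMDiffAt_iff]
  refine ⟨h.continuousAt_symm hq, ?_⟩
  rw [h.left_inv hy]
  simp only [modelWithCornersSelf_coe, range_id, contDiffWithinAt_univ]
  exact key

end LocalInverse

/-! ### Curve lengths and local Lipschitz bounds -/

section Lengths

variable {d : ℕ} {N N' : Type*}
  [MetricSpace N] [ChartedSpace (EuclideanSpace ℝ (Fin d)) N]
  [RiemannianBundle fun q : N => TangentSpace (𝓡 d) q]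
  [MetricSpace N'] [ChartedSpace (EuclideanSpace ℝ (Fin d)) N']
  [RiemannianBundle fun q : N' => TangentSpace (𝓡 d) q]

/-- `f` is continuously differentiable on `U` and its differentials preserve norms. -/
def DifferentialIsometryOn (f : N → N') (U : Set N) : Prop :=
  ContMDiffOn (𝓡 d) (𝓡 d) 1 f U ∧
    ∀ q ∈ U, ∀ v : TangentSpace (𝓡 d) q, ‖mfderiv (𝓡 d) (𝓡 d) f q v‖ = ‖v‖

/-- By the chain rule `f ∘ γ` has the same speed as `γ`, and a Riemannian distance is at most the
length of any connecting curve. -/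
theorem DifferentialIsometryOn.edist_le_pathELength [IsRiemannianManifold (𝓡 d) N']
    {f : N → N'} {U : Set N} (hU : IsOpen U) (hf : DifferentialIsometryOn (d := d) f U)
    {γ : ℝ → N} (hγ : ContMDiffOn 𝓘(ℝ, ℝ) (𝓡 d) 1 γ (Icc 0 1)) (hγU : MapsTo γ (Icc 0 1) U) :
    edist (f (γ 0)) (f (γ 1)) ≤ pathELength (𝓡 d) γ 0 1 := by
  rw [IsRiemannianManifold.out (I := 𝓡 d) (f (γ 0)) (f (γ 1))]
  refine (riemannianEDist_le_pathELength (I := 𝓡 d) (γ := f ∘ γ) (hf.1.comp hγ hγU) rfl rfl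
    zero_le_one).trans (le_of_eq ?_)
  rw [pathELength_eq_lintegral_mfderivWithin_Icc, pathELength_eq_lintegral_mfderivWithin_Icc]
  refine setLIntegral_congr_fun measurableSet_Icc fun t ht => ?_
  have hcomp : mfderivWithin 𝓘(ℝ, ℝ) (𝓡 d) (f ∘ γ) (Icc 0 1) t =
      (mfderiv (𝓡 d) (𝓡 d) f (γ t)).comp (mfderivWithin 𝓘(ℝ, ℝ) (𝓡 d) γ (Icc 0 1) t) := by
    apply mfderiv_comp_mfderivWithin
    · exact ((hf.1 _ (hγU ht)).contMDiffAt (hU.mem_nhds (hγU ht))).mdifferentiableAt one_ne_zero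
    · exact hγ.mdifferentiableOn one_ne_zero t ht
    · rw [uniqueMDiffWithinAt_iff_uniqueDiffWithinAt]
      exact uniqueDiffOn_Icc zero_lt_one t ht
  have h2 : mfderivWithin 𝓘(ℝ, ℝ) (𝓡 d) (f ∘ γ) (Icc 0 1) t 1 =
      mfderiv (𝓡 d) (𝓡 d) f (γ t) (mfderivWithin 𝓘(ℝ, ℝ) (𝓡 d) γ (Icc 0 1) t 1) :=
    congr($hcomp 1)
  rw [h2]
  have h3 := hf.2 (γ t) (hγU ht) (mfderivWithin 𝓘(ℝ, ℝ) (𝓡 d) γ (Icc 0 1) t 1)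
  simp only [enorm_eq_nnnorm, ENNReal.coe_inj]
  exact NNReal.eq h3

variable [IsRiemannianManifold (𝓡 d) N] [IsRiemannianManifold (𝓡 d) N']

theorem DifferentialIsometryOn.lipschitzWith {f : N → N'}
    (hf : DifferentialIsometryOn (d := d) f univ) : LipschitzWith 1 f := by
  intro q q'
  rw [ENNReal.coe_one, one_mul]
  refine le_of_forall_gt fun r hr => ?_
  rw [IsRiemannianManifold.out (I := 𝓡 d) q q'] at hr
  obtain ⟨γ, rfl, rfl, hγ, hlt⟩ := exists_lt_of_riemannianEDist_lt hr
  exact (hf.edist_le_pathELength isOpen_univ hγ (mapsTo_univ _ _)).trans_lt hlt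

/-- Nearly shortest curves between points of `U` may leave `U`, hence the smaller ball. Two points
of the ball of radius `ε / 4` are joined by such curves of length less than `ε / 2`, which stay in
the ball of radius `ε`. -/
theorem DifferentialIsometryOn.exists_lipschitzOnWith {f : N → N'} {U : Set N}
    (hU : IsOpen U) (hf : DifferentialIsometryOn (d := d) f U) {q : N} (hq : q ∈ U) :
    ∃ V, IsOpen V ∧ q ∈ V ∧ V ⊆ U ∧ LipschitzOnWith 1 f V := by
  obtain ⟨ε, hε, hεU⟩ := EMetric.isOpen_iff.1 hU q hq
  have hε4 : 0 < ε / 4 := ENNReal.div_pos hε.ne' (by simp)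
  have hadd : ε / 4 + (ε / 4 + ε / 4) ≤ ε := by
    calc ε / 4 + (ε / 4 + ε / 4) ≤ ε / 4 + (ε / 4 + (ε / 4 + ε / 4)) := by gcongr; exact le_self_add
      _ = 4 * (ε / 4) := by ring
      _ = ε := ENNReal.mul_div_cancel (by norm_num) (by norm_num)
  have h4 : ε / 4 ≤ ε := le_self_add.trans hadd
  refine ⟨Metric.eball q (ε / 4), Metric.isOpen_eball, Metric.mem_eball_self hε4,
    (Metric.eball_subset_eball h4).trans hεU, fun x hx y hy => ?_⟩
  rw [ENNReal.coe_one, one_mul]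
  refine le_of_forall_gt fun r hr => ?_
  have hxy : edist x y < ε / 4 + ε / 4 := by
    refine (edist_triangle x q y).trans_lt (ENNReal.add_lt_add hx ?_)
    rw [edist_comm]; exact hy
  -- Capping the length at `ε / 4 + ε / 4` confines the curve to `U`.
  have hr' : edist x y < min r (ε / 4 + ε / 4) := lt_min hr hxy
  rw [IsRiemannianManifold.out (I := 𝓡 d) x y] at hr'
  obtain ⟨γ, rfl, rfl, hγ, hlt⟩ := exists_lt_of_riemannianEDist_lt hr'
  refine (hf.edist_le_pathELength hU hγ fun t ht => hεU ?_).trans_lt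
    (hlt.trans_le (min_le_left _ _))
  have h1 : edist (γ 0) (γ t) ≤ pathELength (𝓡 d) γ 0 1 := by
    rw [IsRiemannianManifold.out (I := 𝓡 d) (γ 0) (γ t)]
    refine (riemannianEDist_le_pathELength (hγ.mono (Icc_subset_Icc le_rfl ht.2)) rfl rfl
      ht.1).trans (pathELength_mono le_rfl ht.2)
  rw [Metric.mem_eball]
  calc edist (γ t) q ≤ edist (γ t) (γ 0) + edist (γ 0) q := edist_triangle _ _ _
    _ < (ε / 4 + ε / 4) + ε / 4 := by
      refine ENNReal.add_lt_add ?_ hx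
      rw [edist_comm]
      exact h1.trans_lt (hlt.trans_le (min_le_right _ _))
    _ ≤ ε := by rw [add_assoc]; exact hadd

end Lengths

theorem euclideanHausdorffMeasure_image_le {Y Z : Type*} [EMetricSpace Y] [MeasurableSpace Y]
    [BorelSpace Y] [EMetricSpace Z] [MeasurableSpace Z] [BorelSpace Z] {K : NNReal} {f : Y → Z}
    {s : Set Y} (hf : LipschitzOnWith K f s) (d : ℕ) :
    μHE[d] (f '' s) ≤ (K : ℝ≥0∞) ^ d * μHE[d] s := by
  simp only [Measure.euclideanHausdorffMeasure_def, Measure.smul_apply]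
  rw [← ENNReal.rpow_natCast, mul_smul_comm]
  exact smul_le_smul_of_nonneg_left (hf.hausdorffMeasure_image_le (Nat.cast_nonneg d)) bot_le

/-! ### Deck transformations and a set meeting every orbit -/

section Covering

variable {d : ℕ} {M : Type*} [MetricSpace M]
  [ChartedSpace (EuclideanSpace ℝ (Fin d)) M]
  [RiemannianBundle fun q : M => TangentSpace (𝓡 d) q]
  {M' : Type*} [MetricSpace M']
  [ChartedSpace (EuclideanSpace ℝ (Fin d)) M']
  [RiemannianBundle fun q : M' => TangentSpace (𝓡 d) q]
  {p : M' → M}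

/-- All tangent spaces are the same vector space with norms depending on the base point; this
transports a norm along a propositional equality of base points such as `p (h.symm q) = q`. -/
theorem norm_tangentSpace_congr {q q' : M} (h : q = q')
    {v : TangentSpace (𝓡 d) q} {v' : TangentSpace (𝓡 d) q'}
    (hv : (v : EuclideanSpace ℝ (Fin d)) = v') : ‖v‖ = ‖v'‖ := by
  subst h
  exact congrArg _ hv

/-- Norm preservation makes the differential of `p` injective, so local sections are `C¹`;
differentiating `p ∘ h.symm = id` shows that they preserve norms as well. -/
theorem IsRiemannianCovering.differentialIsometryOn_symm (hp : IsRiemannianCovering d p)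
    (h : OpenPartialHomeomorph M' M) (hh : p = h) :
    DifferentialIsometryOn (d := d) h.symm h.target := by
  have hp1 : ContMDiff (𝓡 d) (𝓡 d) 1 p := hp.contMDiff.of_le (by exact_mod_cast le_top)
  have hC : ∀ q ∈ h.target, ContMDiffAt (𝓡 d) (𝓡 d) 1 h.symm q := by
    intro q hq
    have hy := h.map_target hq
    have := contMDiffAt_symm_of_injective_mfderiv h hy (hh ▸ hp1.contMDiffAt) (by
      rw [← hh]
      refine (injective_iff_map_eq_zero _).2 fun v hv => ?_
      rw [← norm_eq_zero, ← hp.norm_mfderiv, hv, norm_zero])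
    rwa [h.right_inv hq] at this
  refine ⟨fun q hq => (hC q hq).contMDiffWithinAt, fun q hq v => ?_⟩
  have h1 : MDifferentiableAt (𝓡 d) (𝓡 d) h.symm q := (hC q hq).mdifferentiableAt one_ne_zero
  have h2 : MDifferentiableAt (𝓡 d) (𝓡 d) p (h.symm q) :=
    (hp1 _).mdifferentiableAt one_ne_zero
  have h3 := (h2.hasMFDerivAt.comp q h1.hasMFDerivAt)
  have h4 : HasMFDerivAt (𝓡 d) (𝓡 d) (p ∘ h.symm) q
      (ContinuousLinearMap.id ℝ (TangentSpace (𝓡 d) q)) := by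
    refine (hasMFDerivAt_id q).congr_of_eventuallyEq ?_
    filter_upwards [h.open_target.mem_nhds hq] with x hx
    rw [hh]
    exact h.right_inv hx
  have h5 := hasMFDerivAt_unique h3 h4
  have h6 : mfderiv (𝓡 d) (𝓡 d) p (h.symm q) (mfderiv (𝓡 d) (𝓡 d) h.symm q v) = v :=
    congr($h5 v)
  rw [← hp.norm_mfderiv]
  exact norm_tangentSpace_congr (by rw [hh]; exact h.right_inv hq) h6

/-- Locally such a lift is a local section composed with `p`, hence `C¹`; differentiating `p ∘ F =
p` gives the norms. -/
theorem IsRiemannianCovering.differentialIsometryOn_lift (hp : IsRiemannianCovering d p)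
    {F : M' → M'} (hF : Continuous F) (hpF : ∀ y, p (F y) = p y) :
    DifferentialIsometryOn (d := d) F univ := by
  have hp1 : ContMDiff (𝓡 d) (𝓡 d) 1 p := hp.contMDiff.of_le (by exact_mod_cast le_top)
  have hC : ∀ y, ContMDiffAt (𝓡 d) (𝓡 d) 1 F y := by
    intro y
    obtain ⟨h, hy, hh⟩ := hp.isCoveringMap.isLocalHomeomorph (F y)
    have hs := hp.differentialIsometryOn_symm h hh
    have hpy : p y ∈ h.target := by
      rw [← hpF, hh]; exact h.map_source hy
    have h1 := ((hs.1 _ hpy).contMDiffAt (h.open_target.mem_nhds hpy)).comp y hp1.contMDiffAt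
    refine h1.congr_of_eventuallyEq ?_
    filter_upwards [hF.continuousAt.preimage_mem_nhds (h.open_source.mem_nhds hy)] with x hx
    rw [Function.comp_apply, ← hpF, hh, h.left_inv hx]
  refine ⟨fun y _ => (hC y).contMDiffWithinAt, fun y _ v => ?_⟩
  have h3 := (((hp1 (F y)).mdifferentiableAt one_ne_zero).hasMFDerivAt.comp y
    ((hC y).mdifferentiableAt one_ne_zero).hasMFDerivAt)
  have h4 : HasMFDerivAt (𝓡 d) (𝓡 d) (p ∘ F) y (mfderiv (𝓡 d) (𝓡 d) p y) := by
    refine ((hp1 y).mdifferentiableAt one_ne_zero).hasMFDerivAt.congr_of_eventuallyEq ?_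
    exact .of_forall hpF
  have h5 := hasMFDerivAt_unique h3 h4
  have h6 : mfderiv (𝓡 d) (𝓡 d) p (F y) (mfderiv (𝓡 d) (𝓡 d) F y v) =
    mfderiv (𝓡 d) (𝓡 d) p y v :=
    congr($h5 v)
  rw [← hp.norm_mfderiv, ← hp.norm_mfderiv y]
  exact norm_tangentSpace_congr (hpF y) h6

/-- Simple connectedness lifts `p` through itself with `y ↦ y'` and with `y' ↦ y`. The two lifts are
mutually inverse by uniqueness of lifts, and both are 1-Lipschitz, so they are isometries. -/
theorem IsRiemannianCovering.exists_deckGroup_smul_eq [IsRiemannianManifold (𝓡 d) M']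
    [SimplyConnectedSpace M']
    (hp : IsRiemannianCovering d p) {y y' : M'} (hy : p y = p y') :
    ∃ γ : deckGroup p, γ • y = y' := by
  have : LocallyPathConnectedSpace M' :=
    ChartedSpace.locallyPathConnectedSpace (EuclideanSpace ℝ (Fin d)) M'
  let pc : C(M', M) := ⟨p, hp.isCoveringMap.continuous⟩
  obtain ⟨F, ⟨hF0, hF⟩, -⟩ := hp.isCoveringMap.existsUnique_continuousMap_lifts pc y y' hy.symm
  obtain ⟨G, ⟨hG0, hG⟩, -⟩ := hp.isCoveringMap.existsUnique_continuousMap_lifts pc y' y hy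
  have hFp : ∀ x, p (F x) = p x := fun x => congrFun hF x
  have hGp : ∀ x, p (G x) = p x := fun x => congrFun hG x
  have hGF : G ∘ F = id := hp.isCoveringMap.eq_of_comp_eq (G.continuous.comp F.continuous)
    continuous_id (by ext x; simp [hFp, hGp]) y (by simp [hF0, hG0])
  have hFG : F ∘ G = id := hp.isCoveringMap.eq_of_comp_eq (F.continuous.comp G.continuous)
    continuous_id (by ext x; simp [hFp, hGp]) y' (by simp [hF0, hG0])
  have hFL := (hp.differentialIsometryOn_lift F.continuous hFp).lipschitzWith
  have hGL := (hp.differentialIsometryOn_lift G.continuous hGp).lipschitzWith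
  have hiso : Isometry F := fun a b => by
    refine le_antisymm (by simpa using hFL a b) ?_
    have := hGL (F a) (F b)
    rw [show G (F a) = a from congrFun hGF a, show G (F b) = b from congrFun hGF b] at this
    simpa using this
  exact ⟨⟨⟨⟨F, G, congrFun hGF, congrFun hFG⟩, hiso⟩, hFp⟩, hF0⟩

/-- Countably many 1-Lipschitz local sections suffice. Cutting their domains down to a disjoint
partition of `M` keeps the total volume of the images below that of `M`. -/
theorem IsRiemannianCovering.exists_deckGroup_cover_measure_le
    [MeasurableSpace M] [BorelSpace M] [MeasurableSpace M'] [BorelSpace M']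
    [IsRiemannianManifold (𝓡 d) M] [IsRiemannianManifold (𝓡 d) M'] [SecondCountableTopology M]
    [SimplyConnectedSpace M'] (hp : IsRiemannianCovering d p) :
    ∃ D : Set M', (∀ y, ∃ γ : deckGroup p, γ • y ∈ D) ∧
      μHE[d] D ≤ μHE[d] (univ : Set M) := by
  have hloc : ∀ q : M, ∃ (h : OpenPartialHomeomorph M' M) (V : Set M), p = h ∧ IsOpen V ∧ q ∈ V ∧
      V ⊆ h.target ∧ LipschitzOnWith 1 h.symm V := by
    intro q
    obtain ⟨y, rfl⟩ := hp.surjective q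
    obtain ⟨h, hy, hh⟩ := hp.isCoveringMap.isLocalHomeomorph y
    obtain ⟨V, h1, h2, h3, h4⟩ := (hp.differentialIsometryOn_symm h hh).exists_lipschitzOnWith
      h.open_target (q := p y) (by rw [hh]; exact h.map_source hy)
    exact ⟨h, V, hh, h1, h2, h3, h4⟩
  choose h V hh hVo hqV hVt hVL using hloc
  obtain ⟨T, hTc, hT⟩ := TopologicalSpace.countable_cover_nhds fun q => (hVo q).mem_nhds (hqV q)
  have : Nonempty M := (inferInstance : Nonempty M').map p
  have hTn : T.Nonempty := by
    by_contra hn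
    rw [not_nonempty_iff_eq_empty] at hn
    simp [hn] at hT
    exact (univ_nonempty (α := M)).ne_empty hT.symm
  obtain ⟨t, rfl⟩ := hTc.exists_eq_range hTn
  rw [biUnion_range] at hT
  let W : ℕ → Set M := disjointed fun n => V (t n)
  have hWV : ∀ n, W n ⊆ V (t n) := fun n => disjointed_subset _ n
  have hWm : ∀ n, MeasurableSet (W n) :=
    fun n => MeasurableSet.disjointed (fun n => (hVo (t n)).measurableSet) n
  have hWu : ⋃ n, W n = univ := (iUnion_disjointed).trans hT
  refine ⟨⋃ n, (h (t n)).symm '' W n, fun y => ?_, ?_⟩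
  · have : p y ∈ ⋃ n, W n := hWu ▸ mem_univ _
    obtain ⟨n, hn⟩ := mem_iUnion.1 this
    obtain ⟨γ, hγ⟩ := hp.exists_deckGroup_smul_eq (y := y) (y' := (h (t n)).symm (p y)) (by
      conv_rhs => rw [hh (t n)]
      rw [(h (t n)).right_inv]
      · rw [← hh (t n)]
      · rw [← hh (t n)]; exact hVt _ (hWV n hn))
    exact ⟨γ, mem_iUnion.2 ⟨n, hγ ▸ mem_image_of_mem _ hn⟩⟩
  · calc μHE[d] (⋃ n, (h (t n)).symm '' W n)
        ≤ ∑' n, μHE[d] ((h (t n)).symm '' W n) := measure_iUnion_le _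
      _ ≤ ∑' n, μHE[d] (W n) := by
        refine ENNReal.tsum_le_tsum fun n => ?_
        simpa using euclideanHausdorffMeasure_image_le ((hVL (t n)).mono (hWV n)) d
      _ = μHE[d] (⋃ n, W n) := (measure_iUnion (disjoint_disjointed _) hWm).symm
      _ = μHE[d] univ := by rw [hWu]

end Covering

/-! ### The area inequality -/

section Area

open Filter

theorem encard_le_of_forall_finset {α : Type*} {s : Set α} {a : ℝ≥0∞}
    (h : ∀ T : Finset α, (T : Set α) ⊆ s → (T.card : ℝ≥0∞) ≤ a) : (s.encard : ℝ≥0∞) ≤ a := by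
  rcases s.finite_or_infinite with hs | hs
  · have := h hs.toFinset (by simp)
    rwa [hs.encard_eq_coe_toFinset_card, ENat.toENNReal_coe]
  · rw [hs.encard_eq]
    refine le_of_eq (Eq.symm ?_)
    rw [ENat.toENNReal_top]
    refine ENNReal.eq_top_of_forall_nnreal_le fun r => ?_
    obtain ⟨n, hn⟩ := exists_nat_ge r
    obtain ⟨T, hT, hc⟩ := hs.exists_subset_card_eq n
    calc (r : ℝ≥0∞) ≤ (n : ℝ≥0∞) := by exact_mod_cast hn
      _ ≤ a := hc ▸ h T hT

/-- The area inequality: the multiplicity function of a Lipschitz map has a measurable majorant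
with controlled integral. (Lower integrals of nonmeasurable functions are not subadditive.) -/
theorem exists_measurable_encard_le_lintegral_le {Y Z : Type*} [EMetricSpace Y]
    [SecondCountableTopology Y] [MeasurableSpace Y] [BorelSpace Y] [EMetricSpace Z]
    [MeasurableSpace Z] [BorelSpace Z] {K : NNReal} {f : Y → Z} {P : Set Y}
    (hf : LipschitzOnWith K f P) (d : ℕ) :
    ∃ g : Z → ℝ≥0∞, Measurable g ∧ (∀ b, ((P ∩ f ⁻¹' {b}).encard : ℝ≥0∞) ≤ g b) ∧
      ∫⁻ b, g b ∂μHE[d] ≤ (K : ℝ≥0∞) ^ d * μHE[d] P := by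
  classical
  -- The first `n` bits of an injective binary coding cut `Y` into finitely many measurable cells,
  -- and any finite set of points is separated for large `n`.
  obtain ⟨e, hem, hei⟩ := MeasurableSpace.measurable_injection_nat_bool_of_countablySeparated Y
  let A : ∀ n, (Fin n → Bool) → Set Y := fun n σ => {y | ∀ i : Fin n, e y i = σ i}
  have hAm : ∀ n σ, MeasurableSet (A n σ) := by
    intro n σ
    have : A n σ = ⋂ i : Fin n, (fun y => e y i) ⁻¹' {σ i} := by
      ext y; simp [A]
    rw [this]
    exact MeasurableSet.iInter fun i => ((measurable_pi_apply _).comp hem) (measurableSet_singleton _)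
  -- Images of cells may be nonmeasurable; measurable hulls have the same measure.
  let S : ∀ n, (Fin n → Bool) → Set Z := fun n σ => toMeasurable μHE[d] (f '' (P ∩ A n σ))
  let G : ℕ → Z → ℝ≥0∞ := fun n b => ∑ σ, (S n σ).indicator 1 b
  have hGm : ∀ n, Measurable (G n) := fun n =>
    Finset.measurable_sum _ fun σ _ =>
      (measurable_const (a := (1 : ℝ≥0∞))).indicator (measurableSet_toMeasurable _ _)
  have hGi : ∀ n, ∫⁻ b, G n b ∂μHE[d] ≤ (K : ℝ≥0∞) ^ d * μHE[d] P := by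
    intro n
    have hsum : ∑ σ, μHE[d] (P ∩ A n σ) = μHE[d] P := by
      -- Restricting the measure to `P` gives additivity over the cells without measurability of
      -- `P`.
      have h1 := measure_biUnion_finset (μ := (μHE[d] : Measure Y).restrict P)
        (s := Finset.univ) (f := A n) (by
          intro σ _ τ _ hστ
          refine Set.disjoint_left.2 fun y hy hy' => hστ ?_
          ext i
          rw [← hy i, ← hy' i]) (fun σ _ => hAm n σ)
      have h2 : (⋃ σ ∈ (Finset.univ : Finset (Fin n → Bool)), A n σ) = univ := by
        refine eq_univ_of_forall fun y => ?_
        simp only [Finset.mem_univ, iUnion_true, mem_iUnion]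
        exact ⟨fun i => e y i, fun i => rfl⟩
      rw [h2, Measure.restrict_apply_univ] at h1
      rw [h1]
      refine Finset.sum_congr rfl fun σ _ => ?_
      rw [Measure.restrict_apply (hAm n σ), inter_comm]
    calc ∫⁻ b, G n b ∂μHE[d] = ∑ σ, ∫⁻ b, (S n σ).indicator 1 b ∂μHE[d] :=
          lintegral_finsetSum _ fun σ _ =>
            (measurable_const (a := (1 : ℝ≥0∞))).indicator (measurableSet_toMeasurable _ _)
      _ = ∑ σ, μHE[d] (f '' (P ∩ A n σ)) := by
          refine Finset.sum_congr rfl fun σ _ => ?_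
          rw [lintegral_indicator_one (measurableSet_toMeasurable _ _), measure_toMeasurable]
      _ ≤ ∑ σ, (K : ℝ≥0∞) ^ d * μHE[d] (P ∩ A n σ) :=
          Finset.sum_le_sum fun σ _ =>
            euclideanHausdorffMeasure_image_le (hf.mono inter_subset_left) d
      _ = (K : ℝ≥0∞) ^ d * μHE[d] P := by rw [← Finset.mul_sum, hsum]
  -- The hulls chosen at different `n` need not be nested, so `G n` need not be monotone; Fatou's
  -- lemma for the lower limit replaces monotone convergence.
  refine ⟨fun b => liminf (fun n => G n b) atTop, .liminf hGm, fun b => ?_, ?_⟩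
  · refine encard_le_of_forall_finset fun T hT => ?_
    refine le_liminf_of_le (by isBoundedDefault) ?_
    have hsep : ∀ᶠ n in atTop, ∀ y ∈ T, ∀ z ∈ T, y ≠ z → ∃ i : Fin n, e y i ≠ e z i := by
      simp only [Finset.eventually_all]
      intro y _ z _
      by_cases hyz : y = z
      · exact .of_forall fun n h => absurd hyz h
      · obtain ⟨i, hi⟩ := Function.ne_iff.1 (hei.ne hyz)
        filter_upwards [eventually_gt_atTop i] with n hn _
        exact ⟨⟨i, hn⟩, hi⟩
    filter_upwards [hsep] with n hn
    let ρ : Y → (Fin n → Bool) := fun y i => e y i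
    have hinj : Set.InjOn ρ T := by
      intro y hy z hz hyz
      by_contra hne
      obtain ⟨i, hi⟩ := hn y hy z hz hne
      exact hi (congrFun hyz i)
    calc (T.card : ℝ≥0∞) = ((T.image ρ).card : ℝ≥0∞) := by rw [Finset.card_image_of_injOn hinj]
      _ = ∑ σ ∈ T.image ρ, 1 := by simp
      _ ≤ ∑ σ ∈ T.image ρ, (S n σ).indicator 1 b := by
          refine Finset.sum_le_sum fun σ hσ => ?_
          obtain ⟨y, hy, rfl⟩ := Finset.mem_image.1 hσ
          have hb : b ∈ S n (ρ y) := by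
            refine subset_toMeasurable _ _ ⟨y, ⟨(hT hy).1, fun i => rfl⟩, (hT hy).2⟩
          rw [indicator_of_mem hb]
          rfl
      _ ≤ G n b := Finset.sum_le_sum_of_subset (Finset.subset_univ _)
  · refine (lintegral_liminf_le hGm).trans ?_
    refine (liminf_le_liminf (.of_forall hGi)).trans ?_
    simp

end Area

/-! ### Metric estimates in the rectangular complex -/

section Rect

variable {J : Type*} {a : J → ℝ}

theorem RectComplex.edist_coord_le (b c : RectComplex a) (j : J) :
    edist (b.coord j) (c.coord j) ≤ edist b c :=
  le_iInf fun _ => le_iInf fun _ => le_iInf fun hs => edist_coord_le_length j hs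

theorem RectComplex.continuous_coord (j : J) : Continuous fun b : RectComplex a => b.coord j :=
  LipschitzWith.continuous (K := 1) fun b c => by simpa using RectComplex.edist_coord_le b c j

theorem RectComplex.edist_le_euclidDist {b c : RectComplex a} {F : RectFace J}
    (hb : b.coord ∈ F.cuboid a) (hc : c.coord ∈ F.cuboid a) :
    edist b c ≤ ENNReal.ofReal (euclidDist b.coord c.coord) := by
  refine iInf_le_of_le 1 (iInf_le_of_le (fun i => if i = 0 then b else c)
    (iInf_le_of_le ⟨rfl, rfl, fun i hi => ?_⟩ ?_))
  · obtain rfl : i = 0 := by omega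
    exact ⟨F, hb, hc⟩
  · simp [rectStringLength]

/-- The factor `S.card` in place of its square root is wasteful but keeps the Lipschitz constants
natural numbers. -/
theorem euclidDist_le_of_forall {b c : J → ℝ} {S : Finset J} {δ : ℝ} (hδ : 0 ≤ δ)
    (hS : ∀ j ∉ S, b j = c j) (h : ∀ j ∈ S, |b j - c j| ≤ δ) :
    euclidDist b c ≤ S.card * δ := by
  unfold euclidDist
  rw [finsum_eq_sum_of_support_subset (s := S) _ (fun j hj => by
    by_contra hjS
    exact hj (by simp [hS j hjS]))]
  refine Real.sqrt_le_iff.2 ⟨by positivity, ?_⟩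
  calc ∑ j ∈ S, (b j - c j) ^ 2 ≤ ∑ j ∈ S, δ ^ 2 := by
        refine Finset.sum_le_sum fun j hj => ?_
        rw [← sq_abs]
        exact pow_le_pow_left₀ (abs_nonneg _) (h j hj) 2
    _ = S.card * δ ^ 2 := by simp
    _ ≤ (S.card * δ) ^ 2 := by
        rw [mul_pow]
        refine mul_le_mul_of_nonneg_right ?_ (sq_nonneg _)
        have : S.card ≤ S.card ^ 2 := Nat.le_self_pow two_ne_zero _
        exact_mod_cast this

theorem RectFace.coord_nonneg {F : RectFace J} (ha : ∀ j, 0 < a j) {b : J → ℝ}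
    (hb : b ∈ F.cuboid a) (j : J) : 0 ≤ b j := by
  by_cases h1 : j ∈ F.half
  · exact (hb.1 j h1).1
  by_cases h2 : j ∈ F.one
  · rw [hb.2.1 j h2]; exact (ha j).le
  · exact (hb.2.2 j fun h => h.elim h1 h2).ge

open Classical in
/-- The face with index set `S` whose `j`-th coordinate is maximal. -/
def RectFace.ofMem (S : Finset J) (j : J) : RectFace J where
  half := S.erase j
  one := {j}
  disjoint := by simp
  one_nonempty := Finset.singleton_nonempty j

theorem RectFace.mem_plus_ofMem {S : Finset J} {j : J} (hj : j ∈ S) (k : J) :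
    k ∈ (RectFace.ofMem S j).plus ↔ k ∈ S := by
  simp only [RectFace.plus, RectFace.ofMem, mem_ofPred_eq, Finset.mem_erase, Finset.mem_singleton]
  by_cases h : k = j <;> simp [h, hj]

theorem RectFace.mem_cuboid_ofMem {S : Finset J} {j : J} (hj : j ∈ S) {b : J → ℝ}
    (h0 : ∀ k, b k ∈ Icc 0 (a k)) (h1 : b j = a j) (h2 : ∀ k ∉ S, b k = 0) :
    b ∈ (RectFace.ofMem S j).cuboid a := by
  refine ⟨fun k _ => h0 k, fun k hk => ?_, fun k hk => h2 k fun h => hk ?_⟩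
  · rw [Finset.mem_singleton.1 hk, h1]
  · exact (RectFace.mem_plus_ofMem hj k).2 h

end Rect

/-! ### The Cantor nerve map and Borel fundamental domains -/

namespace CantorCover

variable {Γ X Y J : Type*} [Group Γ] [TopologicalSpace X] [MulAction Γ X]
  [MetricSpace Y] [MulAction Γ Y] [MulAction Γ J]

/-- The indices of the members of the cover that contain a given point. -/
def activeSet (U : CantorCover Γ X Y J) (v : X × Y) : Set J :=
  {j | v.1 ∈ U.base j ∧ v.2 ∈ U.ball j}

/-- As a truncation of `2 * (r - dist)` to `[0, r]`, the coordinate is visibly 2-Lipschitz. -/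
theorem nerveCoord_eq (U : CantorCover Γ X Y J) {j : J} {v : X × Y} (h : v.1 ∈ U.base j) :
    U.nerveCoord j v = max 0 (min (U.radius j) (2 * (U.radius j - dist v.2 (U.center j)))) := by
  have hr := U.radius_pos j
  unfold nerveCoord
  split_ifs with h1 h2
  · have h1 : U.radius j ≤ dist v.2 (U.center j) := h1.resolve_right (not_not.2 h)
    rw [max_eq_left]
    exact (min_le_right _ _).trans (by linarith)
  · rw [not_or, not_le] at h1
    rw [min_eq_right (by linarith), max_eq_right (by linarith [h1.1])]
  · rw [not_le] at h2
    rw [min_eq_left (by linarith), max_eq_right hr.le]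

theorem nerveCoord_eq_zero (U : CantorCover Γ X Y J) {j : J} {v : X × Y}
    (h : j ∉ U.activeSet v) : U.nerveCoord j v = 0 := by
  unfold nerveCoord
  rw [if_pos]
  by_contra h'
  rw [not_or, not_not, not_le] at h'
  exact h ⟨h'.2, h'.1⟩

theorem nerveCoord_mem_Icc (U : CantorCover Γ X Y J) (j : J) (v : X × Y) :
    U.nerveCoord j v ∈ Icc 0 (U.radius j) := by
  by_cases h : v.1 ∈ U.base j
  · rw [U.nerveCoord_eq h]
    exact ⟨le_max_left _ _, max_le (U.radius_pos j).le (min_le_left _ _)⟩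
  · rw [U.nerveCoord_eq_zero fun h' => h h'.1]
    exact ⟨le_rfl, (U.radius_pos j).le⟩

theorem nerveCoord_eq_radius (U : CantorCover Γ X Y J) {j : J} {v : X × Y} (h : v.1 ∈ U.base j)
    (h' : v.2 ∈ Metric.ball (U.center j) (1 / 2 * U.radius j)) :
    U.nerveCoord j v = U.radius j := by
  rw [mem_ball] at h'
  rw [U.nerveCoord_eq h, min_eq_left (by linarith), max_eq_right (U.radius_pos j).le]

theorem abs_nerveCoord_sub_le (U : CantorCover Γ X Y J) {j : J} {v w : X × Y}
    (hv : v.1 ∈ U.base j) (hw : w.1 ∈ U.base j) :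
    |U.nerveCoord j v - U.nerveCoord j w| ≤ 2 * dist v.2 w.2 := by
  rw [U.nerveCoord_eq hv, U.nerveCoord_eq hw]
  refine (abs_max_sub_max_le_max _ _ _ _).trans (max_le (by simp) ?_)
  refine (abs_min_sub_min_le_max _ _ _ _).trans (max_le (by simp) ?_)
  rw [← mul_sub, abs_mul, abs_two, sub_sub_sub_cancel_left, abs_sub_comm]
  exact mul_le_mul_of_nonneg_left (abs_dist_sub_le _ _ _) zero_le_two

theorem exists_mem_half (U : CantorCover Γ X Y J) (v : X × Y) :
    ∃ j, v.1 ∈ U.base j ∧ v.2 ∈ Metric.ball (U.center j) (1 / 2 * U.radius j) := by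
  obtain ⟨j, hj⟩ := mem_iUnion.1 (U.half_cover.symm ▸ mem_univ v)
  exact ⟨j, hj⟩

theorem mem_activeSet_of_half (U : CantorCover Γ X Y J) {j : J} {v : X × Y}
    (h : v.1 ∈ U.base j) (h' : v.2 ∈ Metric.ball (U.center j) (1 / 2 * U.radius j)) :
    j ∈ U.activeSet v :=
  ⟨h, ball_subset_ball (by linarith [U.radius_pos j]) h'⟩

variable [IsIsometricSMul Γ Y]

theorem NoSelfIntersections.eq_one {U : CantorCover Γ X Y J} (hU : U.NoSelfIntersections)
    {v : X × Y} {γ : Γ} {j : J} (h : j ∈ U.activeSet v) (h' : γ • j ∈ U.activeSet v) : γ = 1 := by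
  refine hU γ j ⟨v, ⟨?_, ?_⟩, h⟩
  · rw [← U.base_smul]; exact h'.1
  · rw [← U.smul_ball]; exact h'.2

/-- Each of the finitely many orbits contributes at most one member at a given point. -/
theorem NoSelfIntersections.finite_activeSet {U : CantorCover Γ X Y J}
    (hU : U.NoSelfIntersections) (v : X × Y) : (U.activeSet v).Finite := by
  have := U.cofinite
  refine Set.Finite.of_finite_image (f := fun j => (Quotient.mk'' j : MulAction.orbitRel.Quotient Γ J))
    (toFinite _) fun j hj k hk hjk => ?_
  obtain ⟨γ, hγ⟩ := Quotient.eq''.1 hjk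
  change γ • k = j at hγ
  subst hγ
  rw [hU.eq_one hk hj, one_smul]

theorem mem_activeSet_smul (U : CantorCover Γ X Y J) (γ : Γ) (v : X × Y) (j : J) :
    γ • j ∈ U.activeSet (γ • v) ↔ j ∈ U.activeSet v := by
  refine and_congr ?_ ?_
  · rw [U.base_smul]; exact smul_mem_smul_set_iff
  · rw [U.smul_ball]; exact smul_mem_smul_set_iff

theorem nerveCoord_smul (U : CantorCover Γ X Y J) (γ : Γ) (v : X × Y) (j : J) :
    U.nerveCoord j (γ • v) = U.nerveCoord (γ⁻¹ • j) v := by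
  obtain ⟨k, rfl⟩ : ∃ k, j = γ • k := ⟨γ⁻¹ • j, (smul_inv_smul γ j).symm⟩
  rw [inv_smul_smul]
  by_cases h : v.1 ∈ U.base k
  · have h' : (γ • v).1 ∈ U.base (γ • k) := by
      rw [U.base_smul]; exact smul_mem_smul_set h
    rw [U.nerveCoord_eq h, U.nerveCoord_eq h', U.radius_smul, U.center_smul, Prod.smul_snd,
      dist_smul]
  · rw [U.nerveCoord_eq_zero fun h' => h h'.1, U.nerveCoord_eq_zero fun h' => h ?_]
    exact ((U.mem_activeSet_smul γ v k).1 h').1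

theorem NoSelfIntersections.nerveCoord_mem_cuboid {U : CantorCover Γ X Y J}
    (hU : U.NoSelfIntersections) {v : X × Y} {j : J} (h : v.1 ∈ U.base j)
    (h' : v.2 ∈ Metric.ball (U.center j) (1 / 2 * U.radius j)) :
    (fun k => U.nerveCoord k v) ∈
      (RectFace.ofMem (hU.finite_activeSet v).toFinset j).cuboid U.radius :=
  RectFace.mem_cuboid_ofMem (by simpa using U.mem_activeSet_of_half h h')
    (fun k => U.nerveCoord_mem_Icc k v) (U.nerveCoord_eq_radius h h')
    fun k hk => U.nerveCoord_eq_zero (by simpa using hk)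

/-- The point of the rectangular complex with coordinates `Φ_j(v)`. -/
def NoSelfIntersections.nervePoint {U : CantorCover Γ X Y J} (hU : U.NoSelfIntersections)
    (v : X × Y) : RectComplex U.radius where
  coord j := U.nerveCoord j v
  mem := by
    obtain ⟨j, h, h'⟩ := U.exists_mem_half v
    exact ⟨_, hU.nerveCoord_mem_cuboid h h'⟩

theorem NoSelfIntersections.nervePoint_mem {U : CantorCover Γ X Y J}
    (hU : U.NoSelfIntersections) (v : X × Y) : hU.nervePoint v ∈ U.fiberNerve v.1 := by
  obtain ⟨j, h, h'⟩ := U.exists_mem_half v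
  have hj : j ∈ (hU.finite_activeSet v).toFinset := by simpa using U.mem_activeSet_of_half h h'
  refine ⟨_, ⟨fun k hk => ?_, v.2, mem_iInter₂.2 fun k hk => ?_⟩, hU.nerveCoord_mem_cuboid h h'⟩
  all_goals
    rw [RectFace.mem_plus_ofMem hj] at hk
    have hk' : k ∈ U.activeSet v := by simpa using hk
  · exact hk'.1
  · exact hk'.2

/-- The Cantor nerve map. -/
def NoSelfIntersections.nerveMap {U : CantorCover Γ X Y J} (hU : U.NoSelfIntersections) :
    X × Y →[Γ] U.Nerve where
  toFun v := ⟨(v.1, hU.nervePoint v), hU.nervePoint_mem v⟩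
  map_smul' γ v := by
    refine Subtype.ext (Prod.ext rfl ?_)
    ext j
    exact U.nerveCoord_smul γ v j

theorem NoSelfIntersections.isNerveMap_nerveMap {U : CantorCover Γ X Y J}
    (hU : U.NoSelfIntersections) : U.IsNerveMap hU.nerveMap :=
  fun _ => ⟨rfl, fun _ => rfl⟩

/-- The `j`-th coordinate is maximal at both points, so the two images lie in the common face
`RectFace.ofMem S j`, where the path metric is at most the Euclidean one. -/
theorem NoSelfIntersections.edist_nervePoint_le {U : CantorCover Γ X Y J}
    (hU : U.NoSelfIntersections) {S : Finset J} {j : J} {v w : X × Y}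
    (hv : U.activeSet v = S) (hw : U.activeSet w = S)
    (hjv : v.2 ∈ Metric.ball (U.center j) (1 / 2 * U.radius j))
    (hjw : w.2 ∈ Metric.ball (U.center j) (1 / 2 * U.radius j)) (hj : j ∈ S) :
    edist (hU.nervePoint v) (hU.nervePoint w) ≤
      ((2 * S.card : ℕ) : ℝ≥0∞) * edist v.2 w.2 := by
  have hSv : (hU.finite_activeSet v).toFinset = S :=
    Finset.coe_injective (by rw [Finite.coe_toFinset, hv])
  have hSw : (hU.finite_activeSet w).toFinset = S :=
    Finset.coe_injective (by rw [Finite.coe_toFinset, hw])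
  have hv' : ∀ k ∈ S, k ∈ U.activeSet v := fun k hk => by rw [hv]; exact hk
  have hw' : ∀ k ∈ S, k ∈ U.activeSet w := fun k hk => by rw [hw]; exact hk
  have h1 := hU.nerveCoord_mem_cuboid (hv' j hj).1 hjv
  have h2 := hU.nerveCoord_mem_cuboid (hw' j hj).1 hjw
  rw [hSv] at h1
  rw [hSw] at h2
  refine (RectComplex.edist_le_euclidDist h1 h2).trans ?_
  have h3 : euclidDist (hU.nervePoint v).coord (hU.nervePoint w).coord ≤
      S.card * (2 * dist v.2 w.2) := by
    refine euclidDist_le_of_forall (by positivity) (fun k hk => ?_) fun k hk =>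
      U.abs_nerveCoord_sub_le (hv' k hk).1 (hw' k hk).1
    change U.nerveCoord k v = U.nerveCoord k w
    rw [U.nerveCoord_eq_zero (by rw [hv]; exact hk), U.nerveCoord_eq_zero (by rw [hw]; exact hk)]
  refine (ENNReal.ofReal_le_ofReal h3).trans (le_of_eq ?_)
  rw [edist_dist, ← ENNReal.ofReal_natCast, ← ENNReal.ofReal_mul (Nat.cast_nonneg _)]
  push_cast
  ring_nf

/-- The positive coordinates of a nerve point belong to members with a common point, so each orbit
of `J` supplies at most one of them. With the orbits numbered, exactly one translation moves the
positive index of the least occurring orbit to the chosen representative of that orbit. -/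
theorem exists_isBorelFundamentalDomain {U : CantorCover Γ X Y J} (hU : U.NoSelfIntersections) :
    ∃ F : Set U.Nerve, IsBorelFundamentalDomain Γ F := by
  have := U.cofinite
  obtain ⟨n, ⟨e⟩⟩ := Finite.exists_equiv_fin (MulAction.orbitRel.Quotient Γ J)
  let q : J → MulAction.orbitRel.Quotient Γ J := fun j => Quotient.mk'' j
  have hq : ∀ (γ : Γ) (j : J), q (γ • j) = q j := fun γ j => Quotient.sound' ⟨γ, rfl⟩
  have hcont : ∀ j, Continuous fun w : U.Nerve => w.1.2.coord j := fun j =>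
    (RectComplex.continuous_coord j).comp (continuous_snd.comp continuous_subtype_val)
  let F : Set U.Nerve := ⋃ i : MulAction.orbitRel.Quotient Γ J,
    {w : U.Nerve | 0 < w.1.2.coord i.out} ∩
      ⋂ j : {j : J // e (q j) < e i}, {w : U.Nerve | w.1.2.coord j = 0}
  refine ⟨F, ?_, fun w => ?_⟩
  · refine MeasurableSet.iUnion fun i => ?_
    exact (isOpen_lt continuous_const (hcont _)).measurableSet.inter
      -- The intersection is closed, so no countability of `J` is needed.
      (isClosed_iInter fun j => isClosed_eq (hcont _) continuous_const).measurableSet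
  obtain ⟨G, ⟨hG1, y, hy⟩, hG⟩ := w.2
  have hnn : ∀ j, 0 ≤ w.1.2.coord j := fun j => G.coord_nonneg U.radius_pos hG j
  have hact : ∀ j, 0 < w.1.2.coord j → j ∈ U.activeSet (w.1.1, y) := by
    intro j hj
    have hjG : j ∈ G.plus := by
      by_contra h
      exact hj.ne' (hG.2.2 j h)
    exact ⟨hG1 j hjG, mem_iInter₂.1 hy j hjG⟩
  obtain ⟨j0, hj0⟩ := G.one_nonempty
  obtain ⟨j, hj, hmin⟩ := (InvImage.wf (fun j => e (q j)) (wellFounded_lt (α := Fin n))).has_min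
    {j | 0 < w.1.2.coord j} ⟨j0, by
      rw [mem_ofPred_eq, hG.2.1 j0 hj0]; exact U.radius_pos j0⟩
  replace hmin : ∀ k, 0 < w.1.2.coord k → e (q j) ≤ e (q k) := fun k hk => not_lt.1 (hmin k hk)
  have hzero : ∀ k, e (q k) < e (q j) → w.1.2.coord k = 0 := fun k hk => by
    by_contra h
    exact hk.not_ge (hmin k ((hnn k).lt_of_ne' h))
  obtain ⟨g, hg⟩ : ∃ g : Γ, g • j = (q j).out := Quotient.mk_out (s := MulAction.orbitRel Γ J) j
  have hsmul : ∀ (γ : Γ) (k : J), (γ • w).1.2.coord k = w.1.2.coord (γ⁻¹ • k) := fun _ _ => rfl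
  refine ⟨g, mem_iUnion.2 ⟨q j, ?_, mem_iInter.2 fun k => ?_⟩, fun γ hγ => ?_⟩
  · rw [mem_ofPred_eq, hsmul, ← hg, inv_smul_smul]
    exact hj
  · rw [mem_ofPred_eq, hsmul]
    refine hzero _ ?_
    rw [hq]
    exact k.2
  · obtain ⟨i, hi, hi'⟩ := mem_iUnion.1 hγ
    rw [mem_ofPred_eq, hsmul] at hi
    have hqi : q (γ⁻¹ • i.out) = i := by
      rw [hq]
      exact Quotient.out_eq' i
    have hij : q j = i := by
      refine e.injective (le_antisymm (hqi ▸ hmin _ hi) ?_)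
      by_contra! hlt
      have := mem_iInter.1 hi' ⟨γ • j, by rw [hq]; exact hlt⟩
      rw [mem_ofPred_eq, hsmul, inv_smul_smul] at this
      exact hj.ne' this
    rw [← hij, ← hg, smul_smul] at hi
    have := hU.eq_one (hact _ hj) (hact _ hi)
    exact (inv_mul_eq_one.1 this)

end CantorCover

theorem encard_iUnion_le_tsum {α ι : Type*} [Countable ι] (s : ι → Set α) :
    ((⋃ i, s i).encard : ℝ≥0∞) ≤ ∑' i, ((s i).encard : ℝ≥0∞) := by
  let _ : MeasurableSpace α := ⊤
  have h := measure_iUnion_le (μ := Measure.count) s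
  simpa only [Measure.count_apply (MeasurableSpace.measurableSet_top)] using h

/-! ### Reduction to an integral of the multiplicity -/

namespace CantorCover

variable {Γ X Y J : Type*} [Group Γ] [TopologicalSpace X] [MulAction Γ X]
  [MetricSpace Y] [MulAction Γ Y] [MulAction Γ J]

/-- The number of members of the cover that contain a given point. -/
def multiplicity (U : CantorCover Γ X Y J) (v : X × Y) : ℝ≥0∞ :=
  ∑' j, (U.base j ×ˢ U.ball j).indicator 1 v

theorem multiplicity_eq_card (U : CantorCover Γ X Y J) {v : X × Y} {S : Finset J}
    (h : U.activeSet v = S) : U.multiplicity v = S.card := by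
  classical
  have h1 : ∀ j, (U.base j ×ˢ U.ball j).indicator (1 : X × Y → ℝ≥0∞) v =
      (S : Set J).indicator 1 j := by
    intro j
    rw [← h]
    by_cases hj : j ∈ U.activeSet v
    · rw [indicator_of_mem hj, indicator_of_mem (show v ∈ U.base j ×ˢ U.ball j from hj)]; rfl
    · rw [indicator_of_notMem hj, indicator_of_notMem (show v ∉ U.base j ×ˢ U.ball j from hj)]
  unfold multiplicity
  simp_rw [h1]
  rw [tsum_eq_sum (s := S) (fun j hj => indicator_of_notMem (by exact_mod_cast hj) _),
    Finset.sum_congr rfl (fun j hj => indicator_of_mem (by exact_mod_cast hj) _)]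
  simp

variable [MeasurableSpace X] [BorelSpace X] [MeasurableSpace Y] [BorelSpace Y]

theorem measurableSet_prod (U : CantorCover Γ X Y J) (j : J) :
    MeasurableSet (U.base j ×ˢ U.ball j) :=
  (U.isClopen_base j).2.measurableSet.prod isOpen_ball.measurableSet

theorem measurableSet_activeSet_eq [Countable J] (U : CantorCover Γ X Y J) (S : Set J) :
    MeasurableSet {v : X × Y | U.activeSet v = S} := by
  classical
  have : {v : X × Y | U.activeSet v = S} = ⋂ j, if j ∈ S then U.base j ×ˢ U.ball j
      else (U.base j ×ˢ U.ball j)ᶜ := by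
    ext v
    rw [mem_ofPred_eq, Set.ext_iff, mem_iInter]
    refine forall_congr' fun j => ?_
    have hj : j ∈ U.activeSet v ↔ v ∈ U.base j ×ˢ U.ball j := Iff.rfl
    split_ifs with h <;> simp [hj, h]
  rw [this]
  refine MeasurableSet.iInter fun j => ?_
  split_ifs
  · exact U.measurableSet_prod j
  · exact (U.measurableSet_prod j).compl

variable [IsIsometricSMul Γ Y]

/-- The space `X × Y` decomposes into countably many pieces of constant multiplicity on which the
Cantor nerve map is Lipschitz. -/
theorem NoSelfIntersections.exists_decomposition [Countable J] [Nonempty X] [Nonempty Y]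
    {U : CantorCover Γ X Y J} (hU : U.NoSelfIntersections) :
    ∃ (P : ℕ → Set (X × Y)) (k : ℕ → ℕ), (∀ n, MeasurableSet (P n)) ∧
      Pairwise (fun m n => Disjoint (P m) (P n)) ∧ ⋃ n, P n = univ ∧
      (∀ n, ∀ v ∈ P n, U.multiplicity v = k n) ∧
      ∀ n, ∀ v ∈ P n, ∀ w ∈ P n, edist (hU.nervePoint v) (hU.nervePoint w) ≤
        ((2 * k n : ℕ) : ℝ≥0∞) * edist v.2 w.2 := by
  -- A piece records the active set, which fixes the multiplicity, and an index whose half ball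
  -- contains the point, which puts all images in one face.
  let ι := {s : Finset J × J // s.2 ∈ s.1}
  let Q : ι → Set (X × Y) := fun s => {v | U.activeSet v = s.1.1} ∩
    Prod.snd ⁻¹' Metric.ball (U.center s.1.2) (1 / 2 * U.radius s.1.2)
  have hQ : ∀ v, ∃ s, v ∈ Q s := fun v => by
    obtain ⟨j, h, h'⟩ := U.exists_mem_half v
    exact ⟨⟨((hU.finite_activeSet v).toFinset, j), by simpa using U.mem_activeSet_of_half h h'⟩,
      by simp, h'⟩
  have hne : Nonempty ι := by
    obtain ⟨v⟩ : Nonempty (X × Y) := inferInstance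
    exact ⟨(hQ v).choose⟩
  obtain ⟨f, hf⟩ := exists_surjective_nat ι
  have hsub : ∀ n, disjointed (fun n => Q (f n)) n ⊆ Q (f n) := fun n => disjointed_subset _ n
  refine ⟨disjointed fun n => Q (f n), fun n => (f n).1.1.card, fun n => ?_, disjoint_disjointed _,
    ?_, fun n v hv => ?_, fun n v hv w hw => ?_⟩
  · refine MeasurableSet.disjointed (fun n => ?_) n
    exact (U.measurableSet_activeSet_eq _).inter (measurable_snd isOpen_ball.measurableSet)
  · rw [iUnion_disjointed]
    refine eq_univ_of_forall fun v => ?_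
    obtain ⟨s, hs⟩ := hQ v
    obtain ⟨n, rfl⟩ := hf s
    exact mem_iUnion.2 ⟨n, hs⟩
  · exact U.multiplicity_eq_card (hsub n hv).1
  · exact hU.edist_nervePoint_le (hsub n hv).1 (hsub n hw).1 (hsub n hv).2 (hsub n hw).2 (f n).2

/-- On each of the countably many measurable pieces the map is continuous, by the Lipschitz bound in
the `Y`-direction. -/
theorem NoSelfIntersections.measurable_nerveMap [Countable J] [Nonempty X] [Nonempty Y]
    [SecondCountableTopology Y] {U : CantorCover Γ X Y J} (hU : U.NoSelfIntersections) :
    Measurable hU.nerveMap := by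
  obtain ⟨P, k, hPm, -, hPu, -, hPL⟩ := hU.exists_decomposition
  have hcont : ∀ n, ContinuousOn (fun v => (v.1, hU.nervePoint v)) (P n) := by
    intro n
    refine continuousOn_fst.prodMk fun v hv => ?_
    rw [ContinuousWithinAt, tendsto_iff_edist_tendsto_0]
    have hlim : Filter.Tendsto (fun w : X × Y => ((2 * k n : ℕ) : ℝ≥0∞) * edist w.2 v.2)
        (nhdsWithin v (P n)) (nhds 0) := by
      have h0 : Filter.Tendsto (fun w : X × Y => edist w.2 v.2) (nhdsWithin v (P n)) (nhds 0) := by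
        rw [← tendsto_iff_edist_tendsto_0]
        exact continuousAt_snd.continuousWithinAt
      simpa using ENNReal.Tendsto.const_mul h0 
        (Or.inr (ENNReal.natCast_ne_top (2 * k n)))
    refine tendsto_of_tendsto_of_tendsto_of_le_of_le' tendsto_const_nhds hlim
      (.of_forall fun _ => bot_le) ?_
    filter_upwards [self_mem_nhdsWithin] with w hw
    exact hPL n w hw v hv
  refine measurable_of_isOpen fun O hO => ?_
  obtain ⟨O', hO', rfl⟩ := isOpen_induced_iff.1 hO
  have hpre : hU.nerveMap ⁻¹' (Subtype.val ⁻¹' O') =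
      ⋃ n, (fun v => (v.1, hU.nervePoint v)) ⁻¹' O' ∩ P n := by
    rw [← inter_iUnion, hPu, inter_univ]
    rfl
  rw [hpre]
  refine MeasurableSet.iUnion fun n => ?_
  obtain ⟨u, hu, hu'⟩ := continuousOn_iff'.1 (hcont n) O' hO'
  rw [hu']
  exact hu.measurableSet.inter (hPm n)

/-- The orbits over `Γ(x, b)` are counted by points of the single fiber over `x`, and the area
inequality applies there to each piece with constant `2 * k n`. -/
theorem NoSelfIntersections.lintegral_fiber_le [Countable J] [Nonempty Y]
    [SecondCountableTopology Y] {U : CantorCover Γ X Y J} (hU : U.NoSelfIntersections)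
    (d : ℕ) {F : Set U.Nerve} (hF : MeasurableSet F) (x : X) :
    ∫⁻ b : U.fiberNerve x,
      F.indicator (fun w => ((orbitMap hU.nerveMap ⁻¹' {Quotient.mk'' w}).encard : ℝ≥0∞))
        ⟨(x, b.1), b.2⟩ ∂μHE[d] ≤
    ∫⁻ p, (hU.nerveMap ⁻¹' F).indicator (fun v => (2 * U.multiplicity v) ^ d) (x, p) ∂μHE[d] := by
  have : Nonempty X := ⟨x⟩
  obtain ⟨P, k, hPm, hPd, hPu, hPk, hPL⟩ := hU.exists_decomposition
  have hEm : MeasurableSet (hU.nerveMap ⁻¹' F) := hU.measurable_nerveMap hF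
  let f : Y → U.fiberNerve x := fun p => ⟨hU.nervePoint (x, p), hU.nervePoint_mem (x, p)⟩
  let R : ℕ → Set Y := fun n => {p | (x, p) ∈ P n ∧ (x, p) ∈ hU.nerveMap ⁻¹' F}
  have hRm : ∀ n, MeasurableSet (R n) := fun n =>
    measurable_prodMk_left ((hPm n).inter hEm)
  have hRd : Pairwise (fun m n => Disjoint (R m) (R n)) := fun m n hmn =>
    Set.disjoint_left.2 fun p hp hp' => Set.disjoint_left.1 (hPd hmn) hp.1 hp'.1
  have hfL : ∀ n, LipschitzOnWith ((2 * k n : ℕ) : NNReal) f (R n) := fun n p hp q hq => by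
    have := hPL n _ hp.1 _ hq.1
    exact_mod_cast this
  choose g hgm hg hgi using fun n => exists_measurable_encard_le_lintegral_le (hfL n) d
  have hmaj : ∀ b : U.fiberNerve x,
      F.indicator (fun w => ((orbitMap hU.nerveMap ⁻¹' {Quotient.mk'' w}).encard : ℝ≥0∞))
        ⟨(x, b.1), b.2⟩ ≤ ∑' n, g n b := by
    intro b
    refine indicator_apply_le' (fun hb => ?_) fun _ => bot_le
    let A : Set Y := ⋃ n, R n ∩ f ⁻¹' {b}
    -- An orbit over the class of `(x, b)` can be translated so that its representative maps to `(x,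
    -- b)` itself; this representative then lies over `x`.
    have hA : orbitMap hU.nerveMap ⁻¹' {Quotient.mk'' (⟨(x, b.1), b.2⟩ : U.Nerve)} ⊆
        (fun p => Quotient.mk'' (x, p)) '' A := by
      intro o ho
      induction o using Quotient.inductionOn' with | h v => ?_
      obtain ⟨γ, hγ⟩ := Quotient.eq''.1 ho.symm
      change γ • hU.nerveMap v = _ at hγ
      rw [← map_smul] at hγ
      have h1 : (γ • v).1 = x := congrArg (fun w : U.Nerve => w.1.1) hγ
      have h2 : γ • v = (x, (γ • v).2) := Prod.ext h1 rfl
      refine ⟨(γ • v).2, ?_, ?_⟩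
      · obtain ⟨n, hn⟩ := mem_iUnion.1 (hPu.symm ▸ mem_univ (γ • v) : γ • v ∈ ⋃ n, P n)
        rw [h2] at hn hγ
        refine mem_iUnion.2 ⟨n, ⟨hn, ?_⟩, ?_⟩
        · rw [mem_preimage, hγ]; exact hb
        · exact Subtype.ext (congrArg (fun w : U.Nerve => w.1.2) hγ)
      · simp only []
        rw [← h2]
        exact Quotient.sound' ⟨γ, rfl⟩
    calc _ ≤ (A.encard : ℝ≥0∞) := by
          exact_mod_cast (encard_le_encard hA).trans (encard_image_le _ _)
      _ ≤ ∑' n, ((R n ∩ f ⁻¹' {b}).encard : ℝ≥0∞) := encard_iUnion_le_tsum _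
      _ ≤ ∑' n, g n b := ENNReal.tsum_le_tsum fun n => hg n b
  calc _ ≤ ∫⁻ b, ∑' n, g n b ∂μHE[d] := lintegral_mono hmaj
    _ = ∑' n, ∫⁻ b, g n b ∂μHE[d] := lintegral_tsum fun n => (hgm n).aemeasurable
    _ ≤ ∑' n, (2 * k n : ℝ≥0∞) ^ d * μHE[d] (R n) :=
        ENNReal.tsum_le_tsum fun n => (hgi n).trans (by push_cast; exact le_rfl)
    _ = ∑' n, ∫⁻ p in R n, (2 * U.multiplicity (x, p)) ^ d ∂μHE[d] := by
        refine tsum_congr fun n => ?_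
        rw [setLIntegral_congr_fun (hRm n) (g := fun _ => (2 * k n : ℝ≥0∞) ^ d)
          (fun p hp => by simp only [hPk n _ hp.1]), setLIntegral_const]
    _ = ∫⁻ p in ⋃ n, R n, (2 * U.multiplicity (x, p)) ^ d ∂μHE[d] :=
        (lintegral_iUnion hRm hRd _).symm
    _ ≤ _ := by
        rw [← lintegral_indicator (MeasurableSet.iUnion hRm)]
        refine lintegral_mono fun p => ?_
        refine indicator_apply_le' (fun hp => ?_) fun _ => bot_le
        obtain ⟨n, hn⟩ := mem_iUnion.1 hp
        rw [indicator_of_mem hn.2]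

end CantorCover

/-! ### Moments of the multiplicity -/

theorem add_one_pow_succ_le (s n : ℕ) : (s + 1) ^ (n + 1) ≤ (n + 1) * (s + 1) ^ n + s ^ (n + 1) := by
  induction n with
  | zero => simp
  | succ n ih =>
    have h1 : s ^ (n + 1) ≤ (s + 1) ^ (n + 1) := Nat.pow_le_pow_left (Nat.le_succ s) _
    calc (s + 1) ^ (n + 1 + 1) = (s + 1) * (s + 1) ^ (n + 1) := by ring
      _ ≤ (s + 1) * ((n + 1) * (s + 1) ^ n + s ^ (n + 1)) := Nat.mul_le_mul_left _ ih
      _ = (n + 1) * (s + 1) ^ (n + 1) + s ^ (n + 1 + 1) + s ^ (n + 1) := by ring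
      _ ≤ (n + 1) * (s + 1) ^ (n + 1) + s ^ (n + 1 + 1) + (s + 1) ^ (n + 1) := by gcongr
      _ = (n + 1 + 1) * (s + 1) ^ (n + 1) + s ^ (n + 1 + 1) := by ring

/-- A discrete form of `s^(n+1) = (n+1) ∫ t^n dt`: elements are inserted by increasing `r`, and a
new maximal element sees the whole set. Ties only enlarge the right-hand side. -/
theorem card_pow_succ_le_sum {ι : Type*} (r : ι → ℝ) (n : ℕ) (S : Finset ι) :
    S.card ^ (n + 1) ≤ (n + 1) * ∑ k ∈ S, (S.filter fun l => r l ≤ r k).card ^ n := by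
  classical
  induction S using Finset.induction_on_max_value r with
  | empty => simp
  | insert a s ha hmax ih =>
    have h1 : (insert a s).filter (fun l => r l ≤ r a) = insert a s := by
      refine Finset.filter_true_of_mem fun l hl => ?_
      rcases Finset.mem_insert.1 hl with rfl | hl
      · exact le_rfl
      · exact hmax l hl
    rw [Finset.sum_insert ha, h1, Finset.card_insert_of_notMem ha, mul_add]
    refine (add_one_pow_succ_le _ _).trans (Nat.add_le_add_left (ih.trans ?_) _)
    refine Nat.mul_le_mul_left _ (Finset.sum_le_sum fun k _ => Nat.pow_le_pow_left ?_ _)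
    exact Finset.card_le_card (Finset.filter_subset_filter _ (Finset.subset_insert a s))

section Unfolding

variable {Γ J V : Type*} [Group Γ] [Countable Γ] [MulAction Γ J] [Countable J] [MulAction Γ V]
  [MeasurableSpace V] [MeasurableConstSMul Γ V] {lam : Measure V} [SMulInvariantMeasure Γ V lam]

/-- Freeness identifies `J` with pairs of an orbit and a group element; the sum over the group moves
`E` through its translates, which tile `V`. -/
theorem lintegral_fundamentalDomain_tsum (hfree : ∀ (γ : Γ) (j : J), γ • j = j → γ = 1)
    {E : Set V} (hE : IsFundamentalDomain Γ E lam) {h : J → V → ℝ≥0∞} (hm : ∀ j, Measurable (h j))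
    (hinv : ∀ (γ : Γ) j v, h (γ • j) (γ • v) = h j v) :
    ∫⁻ v in E, ∑' j, h j v ∂lam =
      ∑' o : MulAction.orbitRel.Quotient Γ J, ∫⁻ v, h o.out v ∂lam := by
  let Q := MulAction.orbitRel.Quotient Γ J
  let e : Q × Γ → J := fun a => a.2 • a.1.out
  have hq : ∀ a : Q × Γ, (Quotient.mk'' (e a) : Q) = a.1 := fun a =>
    (Quotient.sound' ⟨a.2, rfl⟩ : (Quotient.mk'' (e a) : Q) = Quotient.mk'' a.1.out).trans
      (Quotient.out_eq' a.1)
  have he : Function.Bijective e := by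
    refine ⟨fun a b hab => ?_, fun j => ?_⟩
    · have h1 : a.1 = b.1 := by rw [← hq a, ← hq b, hab]
      refine Prod.ext h1 ?_
      have h2 : a.2 • a.1.out = b.2 • a.1.out := by
        conv_rhs => rw [h1]
        exact hab
      have := hfree (b.2⁻¹ * a.2) a.1.out (by rw [mul_smul, h2, inv_smul_smul])
      exact (inv_mul_eq_one.1 this).symm
    · obtain ⟨g, hg⟩ : ∃ g : Γ, g • j = (Quotient.mk'' j : Q).out :=
        Quotient.mk_out (s := MulAction.orbitRel Γ J) j
      exact ⟨(Quotient.mk'' j, g⁻¹), by simp only [e]; rw [← hg, inv_smul_smul]⟩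
  rw [lintegral_tsum fun j => (hm j).aemeasurable,
    ← (Equiv.ofBijective e he).tsum_eq fun j => ∫⁻ v in E, h j v ∂lam, ENNReal.tsum_prod']
  refine tsum_congr fun o => ?_
  rw [hE.lintegral_eq_tsum']
  refine tsum_congr fun γ => lintegral_congr fun v => ?_
  change h (γ • o.out) v = h o.out (γ⁻¹ • v)
  rw [← hinv γ o.out (γ⁻¹ • v), smul_inv_smul]

end Unfolding

namespace CantorCover

variable {Γ X Y J : Type*} [Group Γ] [TopologicalSpace X] [MulAction Γ X]
  [MetricSpace Y] [MulAction Γ Y] [MulAction Γ J]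

/-- The points contained in the `j`-th member of the cover, if its radius is at most `ρ`. -/
def smallMember (U : CantorCover Γ X Y J) (ρ : ℝ) (j : J) : Set (X × Y) :=
  {v | U.radius j ≤ ρ ∧ j ∈ U.activeSet v}

/-- The number of members of the cover of radius at most `ρ` that contain a given point. -/
def levelMultiplicity (U : CantorCover Γ X Y J) (ρ : ℝ) (v : X × Y) : ℝ≥0∞ :=
  ∑' j, (U.smallMember ρ j).indicator 1 v

theorem levelMultiplicity_eq_card (U : CantorCover Γ X Y J) {ρ : ℝ} {v : X × Y} {S : Finset J}
    (h : ∀ j, j ∈ S ↔ v ∈ U.smallMember ρ j) : U.levelMultiplicity ρ v = S.card := by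
  unfold levelMultiplicity
  rw [tsum_eq_sum (s := S) (fun j hj => indicator_of_notMem (fun hv => hj ((h j).2 hv)) _),
    Finset.sum_congr rfl (fun j hj => indicator_of_mem ((h j).1 hj) _)]
  simp

/-- The counting inequality for the active members of radius at most `ρ`. For such a member `k`,
lowering the threshold to its radius counts only members already in this set. -/
theorem levelMultiplicity_pow_succ_le (U : CantorCover Γ X Y J) {v : X × Y}
    (hv : (U.activeSet v).Finite) (ρ : ℝ) (n : ℕ) :
    U.levelMultiplicity ρ v ^ (n + 1) ≤ (n + 1) * ∑' k,
      (U.smallMember ρ k).indicator (fun w => U.levelMultiplicity (U.radius k) w ^ n) v := by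
  classical
  let S : Finset J := hv.toFinset.filter fun j => U.radius j ≤ ρ
  have hS : ∀ j, j ∈ S ↔ v ∈ U.smallMember ρ j := fun j => by
    simp [S, smallMember, and_comm]
  have hk : ∀ k ∈ S, U.levelMultiplicity (U.radius k) v =
      (S.filter fun l => U.radius l ≤ U.radius k).card := by
    intro k hk
    refine U.levelMultiplicity_eq_card fun j => ?_
    have := ((hS k).1 hk).1
    simp only [Finset.mem_filter, hS, smallMember, mem_ofPred_eq]
    exact ⟨fun h => ⟨h.2, h.1.2⟩, fun h => ⟨⟨h.1.trans this, h.2⟩, h.1⟩⟩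
  have hsum : ∑' k, (U.smallMember ρ k).indicator
        (fun w => U.levelMultiplicity (U.radius k) w ^ n) v =
      ((∑ k ∈ S, (S.filter fun l => U.radius l ≤ U.radius k).card ^ n : ℕ) : ℝ≥0∞) := by
    rw [tsum_eq_sum (s := S) (fun j hj => indicator_of_notMem (fun hv => hj ((hS j).2 hv)) _)]
    push_cast
    refine Finset.sum_congr rfl fun k hk' => ?_
    rw [indicator_of_mem ((hS k).1 hk'), hk k hk']
  rw [hsum, U.levelMultiplicity_eq_card hS]
  exact_mod_cast card_pow_succ_le_sum U.radius n S

variable [MeasurableSpace Y] [BorelSpace Y] {d : ℕ}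

theorem IsGood.isGoodBall {U : CantorCover Γ X Y J} (hU : U.IsGood d) {x : X} {j : J}
    (hj : x ∈ U.base j) : IsGoodBall d (U.center j) (U.radius j) :=
  (hU x).good ⟨j, hj⟩

theorem IsGood.disjoint_sixth {U : CantorCover Γ X Y J} (hU : U.IsGood d) {x : X} {j k : J}
    (hj : x ∈ U.base j) (hk : x ∈ U.base k) (hjk : j ≠ k) :
    Disjoint (Metric.ball (U.center j) (1 / 6 * U.radius j))
      (Metric.ball (U.center k) (1 / 6 * U.radius k)) :=
  (hU x).sixth_disjoint (i := ⟨j, hj⟩) (j := ⟨k, hk⟩) fun h => hjk (congrArg Subtype.val h)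

theorem IsGood.multiplicity_eq {U : CantorCover Γ X Y J} (hU : U.IsGood d) (v : X × Y) :
    U.multiplicity v = U.levelMultiplicity (1 / 100) v := by
  refine tsum_congr fun j => ?_
  have : v ∈ U.smallMember (1 / 100) j ↔ v ∈ U.base j ×ˢ U.ball j :=
    ⟨fun h => h.2, fun h => ⟨(hU.isGoodBall h.1).small_radius, h⟩⟩
  classical
  simp only [indicator_apply, this]

theorem IsGood.measure_ball_le_sixth {U : CantorCover Γ X Y J} (hU : U.IsGood d) {x : X} {j : J}
    (hj : x ∈ U.base j) : μHE[d] (U.ball j) ≤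
      10 ^ (4 * (d + 3)) * μHE[d] (Metric.ball (U.center j) (1 / 6 * U.radius j)) := by
  have hr := U.radius_pos j
  refine (measure_mono (ball_subset_ball (by linarith))).trans
    ((hU.isGoodBall hj).reasonable_growth.trans ?_)
  gcongr
  norm_num

/-- Each ball is comparable to its sixth, and these disjoint sixths lie in `100 B_i` since the
centers are within `2 r_i`. Growth is used once for the small balls and once for `B_i`. -/
theorem IsGood.tsum_measure_ball_le [Countable J] {U : CantorCover Γ X Y J} (hU : U.IsGood d)
    {x : X} {i : J} (hi : x ∈ U.base i) {T : Set J}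
    (hT : ∀ k ∈ T, x ∈ U.base k ∧ U.radius k ≤ U.radius i ∧ (U.ball k ∩ U.ball i).Nonempty) :
    ∑' k : T, μHE[d] (U.ball k) ≤ (10 ^ (4 * (d + 3))) ^ 2 * μHE[d] (U.ball i) := by
  have hr := U.radius_pos i
  let D : T → Set Y := fun k => Metric.ball (U.center k) (1 / 6 * U.radius k)
  have hsub : ⋃ k, D k ⊆ Metric.ball (U.center i) (100 * U.radius i) := by
    refine iUnion_subset fun k => ball_subset_ball' ?_
    obtain ⟨-, h1, y, h2, h3⟩ := hT k k.2
    have h4 := dist_triangle_left (U.center k) (U.center i) y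
    have h5 : dist y (U.center k) < U.radius k := h2
    have h6 : dist y (U.center i) < U.radius i := h3
    have := U.radius_pos k
    linarith
  calc ∑' k : T, μHE[d] (U.ball k)
      ≤ ∑' k : T, 10 ^ (4 * (d + 3)) * μHE[d] (D k) :=
        ENNReal.tsum_le_tsum fun k => hU.measure_ball_le_sixth (hT k k.2).1
    _ = 10 ^ (4 * (d + 3)) * ∑' k : T, μHE[d] (D k) := ENNReal.tsum_mul_left
    _ = 10 ^ (4 * (d + 3)) * μHE[d] (⋃ k, D k) := by
        rw [measure_iUnion (fun (j k : T) hjk => hU.disjoint_sixth (hT j j.2).1 (hT k k.2).1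
          fun h => hjk (Subtype.ext h)) fun k => isOpen_ball.measurableSet]
    _ ≤ 10 ^ (4 * (d + 3)) *
        (10 ^ (4 * (d + 3)) * μHE[d] (Metric.ball (U.center i) (1 / 100 * U.radius i))) := by
        gcongr
        exact (measure_mono hsub).trans (hU.isGoodBall hi).reasonable_growth
    _ ≤ 10 ^ (4 * (d + 3)) * (10 ^ (4 * (d + 3)) * μHE[d] (U.ball i)) := by
        gcongr
        exact ball_subset_ball (by linarith)
    _ = _ := by ring

theorem IsGood.tsum_indicator_sixth_le_one {U : CantorCover Γ X Y J} (hU : U.IsGood d)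
    (v : X × Y) :
    ∑' j, (U.base j ×ˢ Metric.ball (U.center j) (1 / 6 * U.radius j)).indicator 1 v ≤
      (1 : ℝ≥0∞) := by
  by_cases h : ∃ j, v ∈ U.base j ×ˢ Metric.ball (U.center j) (1 / 6 * U.radius j)
  · obtain ⟨j, hj⟩ := h
    rw [tsum_eq_single j fun k hk => indicator_of_notMem (fun hv =>
      Set.disjoint_left.1 (hU.disjoint_sixth hv.1 hj.1 hk) hv.2 hj.2) _]
    exact indicator_apply_le' (fun _ => le_rfl) fun _ => bot_le
  · push Not at h
    simp only [indicator_of_notMem (h _), tsum_zero, zero_le]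

theorem measurableSet_ball (U : CantorCover Γ X Y J) (j : J) : MeasurableSet (U.ball j) :=
  isOpen_ball.measurableSet

variable [MeasurableSpace X] [BorelSpace X]

theorem measurableSet_smallMember (U : CantorCover Γ X Y J) (ρ : ℝ) (j : J) :
    MeasurableSet (U.smallMember ρ j) :=
  (MeasurableSet.const _).inter (U.measurableSet_prod j)

theorem measurable_levelMultiplicity [Countable J] (U : CantorCover Γ X Y J) (ρ : ℝ) :
    Measurable (U.levelMultiplicity ρ) :=
  Measurable.tsum fun j => measurable_one.indicator (U.measurableSet_smallMember ρ j)

/-- Induction on the exponent: the counting inequality replaces one power by a sum over smaller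
balls meeting `B_i`. The induction hypothesis applies on each of them, and their total volume costs
a factor `K²`, where `K = 10^(4(d+3))`. -/
theorem IsGood.setLIntegral_levelMultiplicity_pow_le [Countable J] {U : CantorCover Γ X Y J}
    (hU : U.IsGood d) (hfin : ∀ v, (U.activeSet v).Finite) (n : ℕ) {x : X} {i : J}
    (hi : x ∈ U.base i) :
    ∫⁻ p in U.ball i, U.levelMultiplicity (U.radius i) (x, p) ^ n ∂μHE[d] ≤
      n.factorial * (10 ^ (4 * (d + 3))) ^ (2 * n) * μHE[d] (U.ball i) := by
  induction n generalizing i with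
  | zero => simp
  | succ n ih =>
    let T : Set J :=
      {k | x ∈ U.base k ∧ U.radius k ≤ U.radius i ∧ (U.ball k ∩ U.ball i).Nonempty}
    let h : J → Y → ℝ≥0∞ := fun k p => (U.smallMember (U.radius i) k).indicator
      (fun w => U.levelMultiplicity (U.radius k) w ^ n) (x, p)
    have hm : ∀ k, Measurable (h k) := fun k =>
      (((U.measurable_levelMultiplicity _).pow_const n).indicator
        (U.measurableSet_smallMember _ _)).comp measurable_prodMk_left
    have hterm : ∀ k, ∫⁻ p in U.ball i, h k p ∂μHE[d] ≤
        T.indicator (fun k => n.factorial * (10 ^ (4 * (d + 3))) ^ (2 * n) * μHE[d] (U.ball k)) k := by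
      intro k
      by_cases hk : k ∈ T
      · rw [indicator_of_mem hk]
        refine le_trans ?_ (ih hk.1)
        rw [← lintegral_indicator (U.measurableSet_ball k)]
        refine (setLIntegral_le_lintegral _ _).trans (lintegral_mono fun p => ?_)
        refine indicator_apply_le' (fun hp => ?_) fun _ => bot_le
        rw [indicator_of_mem (show p ∈ U.ball k from hp.2.2)]
      · rw [indicator_of_notMem hk]
        refine le_of_eq (setLIntegral_eq_zero (U.measurableSet_ball _) fun p hp => ?_)
        exact indicator_of_notMem (fun hv => hk ⟨hv.2.1, hv.1, p, hv.2.2, hp⟩) _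
    calc ∫⁻ p in U.ball i, U.levelMultiplicity (U.radius i) (x, p) ^ (n + 1) ∂μHE[d]
        ≤ ∫⁻ p in U.ball i, (n + 1) * ∑' k, h k p ∂μHE[d] :=
          lintegral_mono fun p => U.levelMultiplicity_pow_succ_le (hfin _) _ n
      _ = (n + 1) * ∑' k, ∫⁻ p in U.ball i, h k p ∂μHE[d] := by
          rw [lintegral_const_mul _ (Measurable.tsum hm),
            lintegral_tsum fun k => (hm k).aemeasurable]
      _ ≤ (n + 1) * ∑' k, T.indicator (fun k =>
            n.factorial * (10 ^ (4 * (d + 3))) ^ (2 * n) * μHE[d] (U.ball k)) k := by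
          gcongr with k
          exact hterm k
      _ = (n + 1) * (n.factorial * (10 ^ (4 * (d + 3))) ^ (2 * n) *
            ∑' k : T, μHE[d] (U.ball k)) := by
          rw [← tsum_subtype, ENNReal.tsum_mul_left]
      _ ≤ (n + 1) * (n.factorial * (10 ^ (4 * (d + 3))) ^ (2 * n) *
            ((10 ^ (4 * (d + 3))) ^ 2 * μHE[d] (U.ball i))) := by
          gcongr
          exact hU.tsum_measure_ball_le hi fun k hk => hk
      _ = _ := by
          rw [Nat.factorial_succ]
          push_cast
          ring

variable [Countable Γ] [Countable J] [IsIsometricSMul Γ Y]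

/-- Unfolding turns the integral over `E` into moments over whole balls, one for each orbit.
Bounding these by volumes of the disjoint sixths allows folding back to a sum of indicators that is
at most 1 on `E`. -/
theorem IsGood.setLIntegral_multiplicity_pow_le {U : CantorCover Γ X Y J}
    (hU : U.IsGood d) (hfin : ∀ v, (U.activeSet v).Finite) (μ : Measure X)
    [SFinite (μHE[d] : Measure Y)] [MeasurableConstSMul Γ (X × Y)]
    [SMulInvariantMeasure Γ (X × Y) (μ.prod μHE[d])] {E : Set (X × Y)}
    (hE : IsFundamentalDomain Γ E (μ.prod μHE[d])) (n : ℕ) :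
    ∫⁻ v in E, U.multiplicity v ^ n ∂(μ.prod μHE[d]) ≤
      n.factorial * (10 ^ (4 * (d + 3))) ^ (2 * n) * (μ.prod μHE[d]) E := by
  cases n with
  | zero => simp
  | succ n =>
    let K : ℝ≥0∞ := 10 ^ (4 * (d + 3))
    have hK : 1 ≤ K := one_le_pow₀ (by norm_num)
    let h : J → X × Y → ℝ≥0∞ := fun k => (U.smallMember (1 / 100) k).indicator
      (fun w => U.levelMultiplicity (U.radius k) w ^ n)
    have hm : ∀ k, Measurable (h k) := fun k =>
      ((U.measurable_levelMultiplicity _).pow_const n).indicator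
        (U.measurableSet_smallMember _ _)
    have hmem : ∀ (γ : Γ) ρ j v, γ • v ∈ U.smallMember ρ (γ • j) ↔ v ∈ U.smallMember ρ j := by
      intro γ ρ j v
      simp only [smallMember, mem_ofPred_eq, U.radius_smul, U.mem_activeSet_smul]
    have hlev : ∀ (γ : Γ) ρ v, U.levelMultiplicity ρ (γ • v) = U.levelMultiplicity ρ v := by
      intro γ ρ v
      unfold levelMultiplicity
      rw [← (MulAction.toPerm γ : Equiv.Perm J).tsum_eq]
      refine tsum_congr fun j => ?_
      classical
      simp only [MulAction.toPerm_apply, indicator_apply, hmem]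
      rfl
    have hinv : ∀ (γ : Γ) j v, h (γ • j) (γ • v) = h j v := by
      intro γ j v
      classical
      simp only [h, indicator_apply, hmem, hlev, U.radius_smul]
    let D : J → Set (X × Y) := fun j =>
      U.base j ×ˢ Metric.ball (U.center j) (1 / 6 * U.radius j)
    have hDm : ∀ j, MeasurableSet (D j) := fun j =>
      (U.isClopen_base j).2.measurableSet.prod isOpen_ball.measurableSet
    have hDinv : ∀ (γ : Γ) j v, (D (γ • j)).indicator (1 : X × Y → ℝ≥0∞) (γ • v) =
        (D j).indicator 1 v := by
      intro γ j v
      have : γ • v ∈ D (γ • j) ↔ v ∈ D j := by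
        refine and_congr ?_ ?_
        · rw [U.base_smul]; exact smul_mem_smul_set_iff
        · rw [U.center_smul, U.radius_smul, ← Metric.smul_ball]; exact smul_mem_smul_set_iff
      classical
      simp only [indicator_apply, this]
      rfl
    have hterm : ∀ j, ∫⁻ v, h j v ∂(μ.prod μHE[d]) ≤
        n.factorial * K ^ (2 * n) * K * ∫⁻ v, (D j).indicator 1 v ∂(μ.prod μHE[d]) := by
      intro j
      rw [lintegral_indicator_one (hDm j), Measure.prod_prod,
        lintegral_prod _ (hm j).aemeasurable]
      calc ∫⁻ x, ∫⁻ p, h j (x, p) ∂μHE[d] ∂μ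
          ≤ ∫⁻ x, (U.base j).indicator (fun _ => n.factorial * K ^ (2 * n) *
              (K * μHE[d] (Metric.ball (U.center j) (1 / 6 * U.radius j)))) x ∂μ := by
            refine lintegral_mono fun x => ?_
            by_cases hx : x ∈ U.base j
            · rw [indicator_of_mem hx]
              calc ∫⁻ p, h j (x, p) ∂μHE[d]
                  ≤ ∫⁻ p in U.ball j, U.levelMultiplicity (U.radius j) (x, p) ^ n ∂μHE[d] := by
                    rw [← lintegral_indicator (U.measurableSet_ball _)]
                    refine lintegral_mono fun p => ?_
                    refine indicator_apply_le' (fun hp => ?_) fun _ => bot_le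
                    rw [indicator_of_mem (show p ∈ U.ball j from hp.2.2)]
                _ ≤ n.factorial * K ^ (2 * n) * μHE[d] (U.ball j) :=
                    hU.setLIntegral_levelMultiplicity_pow_le hfin n hx
                _ ≤ _ := by
                    gcongr
                    exact hU.measure_ball_le_sixth hx
            · rw [indicator_of_notMem hx]
              refine le_of_eq ((lintegral_congr fun p => ?_).trans lintegral_zero)
              exact indicator_of_notMem (fun hv => hx hv.2.1) _
        _ = _ := by
            rw [lintegral_indicator_const (U.isClopen_base j).2.measurableSet]
            ring
    calc ∫⁻ v in E, U.multiplicity v ^ (n + 1) ∂(μ.prod μHE[d])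
        ≤ ∫⁻ v in E, (n + 1) * ∑' k, h k v ∂(μ.prod μHE[d]) := by
          refine lintegral_mono fun v => ?_
          simp only [hU.multiplicity_eq v]
          exact U.levelMultiplicity_pow_succ_le (hfin _) _ n
      _ = (n + 1) * ∑' o : MulAction.orbitRel.Quotient Γ J,
            ∫⁻ v, h o.out v ∂(μ.prod μHE[d]) := by
          rw [lintegral_const_mul _ (Measurable.tsum hm),
            lintegral_fundamentalDomain_tsum U.free hE hm hinv]
      _ ≤ (n + 1) * ∑' o : MulAction.orbitRel.Quotient Γ J, n.factorial * K ^ (2 * n) * K *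
            ∫⁻ v, (D o.out).indicator 1 v ∂(μ.prod μHE[d]) := by
          gcongr with o
          exact hterm _
      _ = (n + 1) * (n.factorial * K ^ (2 * n) * K *
            ∫⁻ v in E, ∑' j, (D j).indicator 1 v ∂(μ.prod μHE[d])) := by
          rw [ENNReal.tsum_mul_left, lintegral_fundamentalDomain_tsum U.free hE
            (fun j => measurable_one.indicator (hDm j)) hDinv]
      _ ≤ (n + 1) * (n.factorial * K ^ (2 * n) * K * (μ.prod μHE[d]) E) := by
          gcongr
          refine (lintegral_mono fun v => hU.tsum_indicator_sixth_le_one v).trans ?_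
          simp
      -- Only one further factor `K` has appeared; a second is inserted to reach the exponent `2 *
      -- (n + 1)`.
      _ ≤ (n + 1) * (n.factorial * K ^ (2 * n) * (K * K) * (μ.prod μHE[d]) E) := by
          gcongr
          exact le_mul_of_one_le_left' hK
      _ = _ := by
          rw [Nat.factorial_succ]
          push_cast
          ring

end CantorCover

/-! ### Volume of the fundamental domain and conclusion -/

theorem MeasureTheory.IsFundamentalDomain.measure_le_of_exists_smul_mem {Γ V : Type*} [Group Γ]
    [Countable Γ] [MulAction Γ V] [MeasurableSpace V] [MeasurableConstSMul Γ V] {lam : Measure V}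
    [SMulInvariantMeasure Γ V lam] {E T : Set V} (hE : IsFundamentalDomain Γ E lam)
    (hT : ∀ v, ∃ γ : Γ, γ • v ∈ T) : lam E ≤ lam T := by
  rw [hE.measure_eq_tsum T]
  refine (measure_mono fun v hv => ?_).trans (measure_iUnion_le _)
  obtain ⟨γ, hγ⟩ := hT v
  exact mem_iUnion.2 ⟨γ⁻¹, mem_inv_smul_set_iff.2 hγ, hv⟩

instance euclideanHausdorffMeasure.smulInvariantMeasure {Γ Y : Type*} [Group Γ] [MetricSpace Y]
    [MulAction Γ Y] [IsIsometricSMul Γ Y] [MeasurableSpace Y] [BorelSpace Y] (d : ℕ) :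
    SMulInvariantMeasure Γ Y (μHE[d] : Measure Y) where
  measure_preimage_smul γ _ hs :=
    ((IsometryEquiv.constSMul γ : Y ≃ᵢ Y).measurePreserving_euclideanHausdorffMeasure
      d).measure_preimage hs.nullMeasurableSet

theorem MeasureTheory.SMulInvariantMeasure.prod {Γ X Y : Type*} [Group Γ] [MulAction Γ X]
    [MulAction Γ Y] [MeasurableSpace X] [MeasurableSpace Y] [MeasurableConstSMul Γ X]
    [MeasurableConstSMul Γ Y] (μ : Measure X) (ν : Measure Y) [SFinite μ] [SFinite ν]
    [SMulInvariantMeasure Γ X μ] [SMulInvariantMeasure Γ Y ν] :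
    SMulInvariantMeasure Γ (X × Y) (μ.prod ν) where
  measure_preimage_smul γ _ hs :=
    ((measurePreserving_smul γ μ).prod (measurePreserving_smul γ ν)).measure_preimage
      hs.nullMeasurableSet

namespace CantorCover

variable {Γ X Y J : Type*} [Group Γ] [TopologicalSpace X] [MulAction Γ X]
  [MetricSpace Y] [MulAction Γ Y] [MulAction Γ J]

/-- Over one point the sixth balls are disjoint, nonempty and open in a separable space, so they are
countably many. Every nonempty clopen base meets a countable dense set. -/
theorem IsGood.countable_nonempty_base [TopologicalSpace.SeparableSpace X]
    [TopologicalSpace.SeparableSpace Y] [MeasurableSpace Y] [BorelSpace Y] {d : ℕ}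
    {U : CantorCover Γ X Y J} (hU : U.IsGood d) : {j | (U.base j).Nonempty}.Countable := by
  obtain ⟨s, hsc, hsd⟩ := TopologicalSpace.exists_countable_dense X
  have h1 : ∀ x, {j | x ∈ U.base j}.Countable := fun x =>
    Set.PairwiseDisjoint.countable_of_isOpen
      (s := fun j => Metric.ball (U.center j) (1 / 6 * U.radius j))
      (fun j hj k hk hjk => hU.disjoint_sixth hj hk hjk) (fun _ _ => isOpen_ball)
      fun j _ => nonempty_ball.2 (by linarith [U.radius_pos j])
  refine (hsc.biUnion fun x _ => h1 x).mono fun j hj => ?_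
  obtain ⟨x, hx, hxs⟩ := hsd.inter_open_nonempty _ (U.isClopen_base j).2 hj
  exact mem_biUnion hxs hx

/-- By freeness, `Γ` injects into the orbit of an index with nonempty base. -/
theorem IsGood.countable_group [Nonempty X] [Nonempty Y] [TopologicalSpace.SeparableSpace X]
    [TopologicalSpace.SeparableSpace Y] [MeasurableSpace Y] [BorelSpace Y] {d : ℕ}
    {U : CantorCover Γ X Y J} (hU : U.IsGood d) : Countable Γ := by
  obtain ⟨v⟩ : Nonempty (X × Y) := inferInstance
  obtain ⟨j, hj, -⟩ := U.exists_mem_half v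
  have := hU.countable_nonempty_base.to_subtype
  refine Function.Injective.countable
    (f := fun γ : Γ => (⟨γ • j, by
      rw [mem_ofPred_eq, U.base_smul]; exact ⟨_, smul_mem_smul_set hj⟩⟩ :
      {j | (U.base j).Nonempty})) fun γ δ h => ?_
  have h' : γ • j = δ • j := congrArg Subtype.val h
  exact (inv_mul_eq_one.1 (U.free (δ⁻¹ * γ) j (by rw [mul_smul, h', inv_smul_smul]))).symm

theorem countable_index [Countable Γ] (U : CantorCover Γ X Y J) : Countable J := by
  have := U.cofinite
  refine Function.Surjective.countable
    (f := fun a : MulAction.orbitRel.Quotient Γ J × Γ => a.2 • a.1.out) fun j => ?_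
  obtain ⟨g, hg⟩ : ∃ g : Γ, g • j = (Quotient.mk'' j : MulAction.orbitRel.Quotient Γ J).out :=
    Quotient.mk_out (s := MulAction.orbitRel Γ J) j
  exact ⟨(Quotient.mk'' j, g⁻¹), by simp only []; rw [← hg, inv_smul_smul]⟩

theorem NoSelfIntersections.transverseVolume_nerveMap_le [MeasurableSpace X] [BorelSpace X]
    [MeasurableSpace Y] [BorelSpace Y] [SecondCountableTopology X] [SecondCountableTopology Y]
    [Nonempty X] [Nonempty Y] [IsIsometricSMul Γ Y] [ContinuousConstSMul Γ X] {d : ℕ}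
    {μ : Measure X} [IsProbabilityMeasure μ] [SMulInvariantMeasure Γ X μ]
    {U : CantorCover Γ X Y J} (hU : U.NoSelfIntersections) (hg : U.IsGood d) {D : Set Y}
    (hD : ∀ y, ∃ γ : Γ, γ • y ∈ D) (hDf : μHE[d] D ≠ ⊤)
    {F : Set U.Nerve} (hF : IsBorelFundamentalDomain Γ F) :
    U.transverseVolume d μ F hU.nerveMap ≤
      2 ^ d * (d.factorial * (10 ^ (4 * (d + 3))) ^ (2 * d)) * μHE[d] D := by
  have hΓ : Countable Γ := hg.countable_group
  have hJ : Countable J := U.countable_index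
  -- Countably many translates of `D` cover `Y`; sigma-finiteness is needed for the product measure
  -- and Tonelli's theorem.
  have hσ : SigmaFinite (μHE[d] : Measure Y) := by
    refine Measure.sigmaFinite_of_countable (countable_range fun γ : Γ => (γ • ·) ⁻¹' D) ?_ ?_
    · rintro _ ⟨γ, rfl⟩
      rw [measure_preimage_smul]
      exact hDf.lt_top
    · refine eq_univ_of_forall fun y => ?_
      obtain ⟨γ, hγ⟩ := hD y
      exact ⟨_, ⟨γ, rfl⟩, hγ⟩
  have hinv : SMulInvariantMeasure Γ (X × Y) (μ.prod μHE[d]) := .prod μ μHE[d]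
  have hEm : MeasurableSet (hU.nerveMap ⁻¹' F) := hU.measurable_nerveMap hF.1
  have hE : IsFundamentalDomain Γ (hU.nerveMap ⁻¹' F) (μ.prod (μHE[d] : Measure Y)) := by
    refine .mk' hEm.nullMeasurableSet fun v => ?_
    simp only [mem_preimage, map_smul]
    exact hF.2 _
  have hmult : Measurable U.multiplicity :=
    Measurable.tsum fun j => measurable_one.indicator (U.measurableSet_prod j)
  calc U.transverseVolume d μ F hU.nerveMap
      ≤ ∫⁻ x, ∫⁻ p, (hU.nerveMap ⁻¹' F).indicator
          (fun v => (2 * U.multiplicity v) ^ d) (x, p) ∂μHE[d] ∂μ :=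
        lintegral_mono fun x => hU.lintegral_fiber_le d hF.1 x
    _ = ∫⁻ v in hU.nerveMap ⁻¹' F, (2 * U.multiplicity v) ^ d ∂(μ.prod μHE[d]) := by
        rw [← lintegral_indicator hEm, lintegral_prod]
        exact (((hmult.const_mul 2).pow_const d).indicator hEm).aemeasurable
    _ = 2 ^ d * ∫⁻ v in hU.nerveMap ⁻¹' F, U.multiplicity v ^ d ∂(μ.prod μHE[d]) := by
        simp_rw [mul_pow]
        rw [lintegral_const_mul _ (hmult.pow_const d)]
    _ ≤ 2 ^ d * (d.factorial * (10 ^ (4 * (d + 3))) ^ (2 * d) *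
          (μ.prod μHE[d]) (hU.nerveMap ⁻¹' F)) := by
        gcongr
        exact hg.setLIntegral_multiplicity_pow_le hU.finite_activeSet μ hE d
    _ ≤ 2 ^ d * (d.factorial * (10 ^ (4 * (d + 3))) ^ (2 * d) * μHE[d] D) := by
        gcongr
        -- `X × D` meets every orbit of the diagonal action, and `μ` has total mass 1.
        refine (hE.measure_le_of_exists_smul_mem (T := univ ×ˢ D) fun v => ?_).trans ?_
        · obtain ⟨γ, hγ⟩ := hD v.2
          exact ⟨γ, mem_univ _, hγ⟩
        · rw [Measure.prod_prod, measure_univ, one_mul]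
    _ = _ := by ring

end CantorCover

theorem theorem6 (d : ℕ) :
    ∃ C : ℝ, 0 < C ∧
      ∀ -- the closed connected Riemannian manifold `M`
        (M : Type*) [MetricSpace M] [MeasurableSpace M] [BorelSpace M]
        [ChartedSpace (EuclideanSpace ℝ (Fin d)) M] [IsManifold (𝓡 d) ∞ M]
        [RiemannianBundle fun q : M => TangentSpace (𝓡 d) q]
        [IsContMDiffRiemannianBundle (𝓡 d) ∞ (EuclideanSpace ℝ (Fin d))
          fun q : M => TangentSpace (𝓡 d) q]
        [IsRiemannianManifold (𝓡 d) M] [CompactSpace M] [ConnectedSpace M]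
        -- its universal covering `p : M' → M` with the induced Riemannian metric
        (M' : Type*) [MetricSpace M'] [MeasurableSpace M'] [BorelSpace M']
        [ChartedSpace (EuclideanSpace ℝ (Fin d)) M'] [IsManifold (𝓡 d) ∞ M']
        [RiemannianBundle fun q : M' => TangentSpace (𝓡 d) q]
        [IsContMDiffRiemannianBundle (𝓡 d) ∞ (EuclideanSpace ℝ (Fin d))
          fun q : M' => TangentSpace (𝓡 d) q]
        [IsRiemannianManifold (𝓡 d) M'] [SecondCountableTopology M'] [SimplyConnectedSpace M']
        (p : M' → M) (_ : IsRiemannianCovering d p)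
        -- the Cantor set `X` with a free continuous action of the deck transformation group
        -- and an invariant Borel probability measure
        (X : Type*) [TopologicalSpace X] [MeasurableSpace X] [BorelSpace X]
        (_ : Nonempty (X ≃ₜ cantorSet))
        [MulAction (deckGroup p) X] [ContinuousConstSMul (deckGroup p) X]
        (_ : ∀ (γ : deckGroup p) (x : X), γ • x = x → γ = 1)
        (μ : Measure X) [IsProbabilityMeasure μ] [SMulInvariantMeasure (deckGroup p) X μ]
        -- a good Cantor cover without self-intersections
        (J : Type*) [MulAction (deckGroup p) J] (U : CantorCover (deckGroup p) X M' J)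
        (_ : U.IsGood d) (_ : U.NoSelfIntersections),
        ∃ Φ : X × M' →[deckGroup p] U.Nerve, U.IsNerveMap Φ ∧
          (∃ F : Set U.Nerve, IsBorelFundamentalDomain (deckGroup p) F) ∧
          ∀ F : Set U.Nerve, IsBorelFundamentalDomain (deckGroup p) F →
            U.transverseVolume d μ F Φ ≤ ENNReal.ofReal C * μHE[d] (univ : Set M) := by
  -- The factor `2 ^ d` comes from the Lipschitz constants `2m`, the rest from the `d`-th moment of
  -- the multiplicity.
  refine ⟨((2 ^ d * (d.factorial * (10 ^ (4 * (d + 3))) ^ (2 * d)) : ℕ) : ℝ), by positivity, ?_⟩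
  intro M _ _ _ _ _ _ _ _ _ _ M' _ _ _ _ _ _ _ _ _ _ p hp X _ _ _ hX _ _ _ μ _ _ J _ U hg hU
  refine ⟨hU.nerveMap, hU.isNerveMap_nerveMap, CantorCover.exists_isBorelFundamentalDomain hU,
    fun F hF => ?_⟩
  obtain ⟨h⟩ := hX
  have : SecondCountableTopology X := h.secondCountableTopology
  have : Nonempty X := nonempty_of_isProbabilityMeasure μ
  have : SecondCountableTopology M := EMetric.secondCountable_of_sigmaCompact M
  rw [ENNReal.ofReal_natCast]
  obtain ⟨D, hD, hDM⟩ := hp.exists_deckGroup_cover_measure_le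
  -- The case split avoids proving that `M` has finite volume; for infinite volume the bound is
  -- trivial because the constant is nonzero.
  rcases eq_or_ne (μHE[d] (univ : Set M)) ⊤ with htop | htop
  · rw [htop, ENNReal.mul_top (by positivity)]
    exact le_top
  · refine (hU.transverseVolume_nerveMap_le hg hD (hDM.trans_lt htop.lt_top).ne hF).trans ?_
    push_cast
    gcongr

end
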